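/- For $n\ge 0$ let $H_n$ be the (physicists') Hermite polynomials, $H_0=1$, $H_{n+1}=2xH_n-H_n'$, and let $$e_n(x)=c_nH_n(x)e^{-x^2/2},\quad x_n(x)=c_nH_n(x)e^{-x^2/4},\quad y_n(x)=c_nH_n(x)e^{-3x^2/4},\qquad c_n=\frac1{\sqrt{2^n\,n!\sqrt\pi}},$$ be regarded as vectors of the complex Hilbert space $L^2(\mathbb R)$, whose scalar product $\langle\cdot,\cdot\rangle$ is linear in the second entry. Let $T$ be the bounded operator $(Tf)(x)=e^{-x^2/4}f(x)$ on $L^2(\mathbb R)$, let $T^{-1}$ be its inverse, with domain the range of $T$, and let $D(\mathbb R)\subset L^2(\mathbb R)$ be the space of compactly supported $C^\infty$ functions. Consider the operators, with domain the Schwartz space, $$H_1=\tfrac12\Big[-\tfrac{d^2}{dx^2}-x\tfrac{d}{dx}+\tfrac12\big(\tfrac{3x^2}{2}-1\big)\Big],\qquad H_2=\tfrac12\Big[-\tfrac{d^2}{dx^2}+x\tfrac{d}{dx}+\tfrac12\big(\tfrac{3x^2}{2}+1\big)\Big].$$ Let $P_n$ be the Legendre polynomials, and let $S_yf=\sum_{n\ge0}\langle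 y_n,f\rangle y_n$ with domain the set of all $f\in L^2(\mathbb R)$ for which the series converges unconditionally in norm. Then: 1. $T$ is self-adjoint and injective, $D(\mathbb R)\subset D(T^{-1})$, and for all $n$: $y_n=Te_n$, $e_n\in D(T^{-1})$ and $x_n=T^{-1}e_n$. 2. $\langle x_n,y_m\rangle=\delta_{n,m}$ for all $n,m$. 3. $\{x_n\}$ and $\{y_n\}$ are both complete: only the zero vector is orthogonal to all $x_n$, and only the zero vector is orthogonal to all $y_n$. 4. $\{x_n\}$ and $\{y_n\}$ are $D(\mathbb R)$-quasi bases: $D(\mathbb R)$ is dense and, for all $f,g\in D(\mathbb R)$, with unconditional convergence, $$\langle f,g\rangle=\sum_{n\ge0}\langle f,x_n\rangle\langle y_n,g\rangle=\sum_{n\ge0}\langle f,y_n\rangle\langle x_n,g\rangle .$$ 5. For all $n$, $$\|y_n\|^2=\sqrt{\tfrac23}\;3^{-n/2}P_n\big(\tfrac2{\sqrt3}\big),\qquad \|x_n\|^2=\sqrt2\;3^{n/2}P_n\big(\tfrac2{\sqrt3}\big),$$ and $\|y_n\|^2\|x_n\|^2\sim\frac{\sqrt3}{\pi}\,\frac{3^n}{n}$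 as $n\to\infty$; so $\sup_n\|y_n\|\|x_n\|=\infty$, and neither $\{x_n\}$ nor $\{y_n\}$ is a (Schauder) basis of $L^2(\mathbb R)$, i.e. a sequence $\{\xi_n\}$ such that every $f$ has a unique expansion $f=\sum_{n\ge0}c_n\xi_n$ with norm convergent partial sums. 6. For all $n$, $y_n$ and $x_n$ are eigenvectors of $H_1$ and of $H_2$ respectively with eigenvalue $n+\frac12$: they are nonzero, lie in the domain, and $H_1y_n=(n+\frac12)y_n$, $H_2x_n=(n+\frac12)x_n$. 7. $H_1$ and $H_2$ are not self-adjoint; indeed no operator in $L^2(\mathbb R)$ that is defined on $D(\mathbb R)$ and agrees there with $H_1$ is self-adjoint, and likewise for $H_2$. 8. $S_y$ is everywhere defined and $S_y=T^2$. -/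

import Mathlib

open MeasureTheory Filter Topology Polynomial
open scoped ContDiff SchwartzMap Asymptotics

namespace GaussHermite

/-! ### Notions for sequences in a Hilbert space

The scalar product `inner ℂ f g` is linear in the second entry. -/

section Hilbert

variable {E : Type*} [NormedAddCommGroup E] [InnerProductSpace ℂ E]

/-- `⟨φ_n, ψ_m⟩ = δ_{n,m}`. -/
def IsBiorthogonal (φ ψ : ℕ → E) : Prop :=
  ∀ n m : ℕ, inner ℂ (φ n) (ψ m) = if n = m then (1 : ℂ) else 0

/-- Completeness (totality): only the zero vector is orthogonal to all `ξ_n`. -/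
def IsCompleteSeq (ξ : ℕ → E) : Prop :=
  ∀ f : E, (∀ n : ℕ, inner ℂ f (ξ n) = 0) → f = 0

/-- Schauder basis: every vector has a unique expansion `f = ∑_{n ≥ 0} c_n ξ_n`
(norm convergence of the partial sums). -/
def IsBasisSeq (ξ : ℕ → E) : Prop :=
  ∀ f : E, ∃! c : ℕ → ℂ,
    Tendsto (fun N : ℕ => ∑ n ∈ Finset.range N, c n • ξ n) atTop (𝓝 f)

/-- `φ` and `ψ` are `G`-quasi bases: `G` is a dense subspace, `φ` and `ψ` are biorthogonal and, for
all `f, g ∈ G`, both weak resolutions of the identity hold (with unconditional convergence). -/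
structure IsQuasiBases (G : Submodule ℂ E) (φ ψ : ℕ → E) : Prop where
  dense : Dense (G : Set E)
  biorthogonal : IsBiorthogonal φ ψ
  hasSum_left : ∀ f ∈ G, ∀ g ∈ G,
    HasSum (fun n : ℕ => inner ℂ f (φ n) * inner ℂ (ψ n) g) (inner ℂ f g)
  hasSum_right : ∀ f ∈ G, ∀ g ∈ G,
    HasSum (fun n : ℕ => inner ℂ f (ψ n) * inner ℂ (φ n) g) (inner ℂ f g)

/-- `v` is an eigenvector of the partially defined operator `A` with eigenvalue `μ`. -/
def IsEigenvectorOf (A : E →ₗ.[ℂ] E) (μ : ℂ) (v : E) : Prop :=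
  v ≠ 0 ∧ ∃ h : v ∈ A.domain, A ⟨v, h⟩ = μ • v

/-- The operator `f ↦ ∑_n ⟨ξ_n, f⟩ ξ_n`, defined on all `f` for which the series converges
(unconditionally) in norm. -/
noncomputable def seriesOp (ξ : ℕ → E) : E →ₗ.[ℂ] E where
  domain :=
    { carrier := {f | Summable fun n : ℕ => (inner ℂ (ξ n) f : ℂ) • ξ n}
      zero_mem' := by simp [summable_zero]
      add_mem' := by
        intro f g hf hg
        simpa [inner_add_right, add_smul] using Summable.add hf hg
      smul_mem' := by
        intro c f hf
        simpa [inner_smul_right, mul_smul] using Summable.const_smul c hf }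
  toFun :=
    { toFun := fun f => ∑' n : ℕ, (inner ℂ (ξ n) (f : E) : ℂ) • ξ n
      map_add' := by
        intro f g
        simpa [inner_add_right, add_smul] using Summable.tsum_add f.2 g.2
      map_smul' := by
        intro c f
        simpa [inner_smul_right, mul_smul] using Summable.tsum_const_smul c f.2 }

end Hilbert

/-! ### The Hilbert space, test functions, polynomials -/

/-- `L²(ℝ)`, complex valued, with Lebesgue measure. -/
abbrev L2R : Type := Lp ℂ 2 (volume : Measure ℝ)

/-- `D(ℝ)`, the compactly supported smooth functions, as a subspace of `L²(ℝ)`. -/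
def testFunctions : Submodule ℂ L2R where
  carrier := {f | ∃ g : ℝ → ℂ, ContDiff ℝ ∞ g ∧ HasCompactSupport g ∧ f =ᵐ[volume] g}
  zero_mem' := ⟨0, contDiff_const, HasCompactSupport.zero, Lp.coeFn_zero _ _ _⟩
  add_mem' := by
    rintro f₁ f₂ ⟨g₁, h₁, c₁, e₁⟩ ⟨g₂, h₂, c₂, e₂⟩
    exact ⟨g₁ + g₂, h₁.add h₂, c₁.add c₂, (Lp.coeFn_add _ _).trans (e₁.add e₂)⟩
  smul_mem' := by
    rintro c f ⟨g, h, hc, e⟩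
    refine ⟨c • g, h.const_smul c, hc.smul_left (f := fun _ => c), ?_⟩
    exact (Lp.coeFn_smul _ _).trans (e.const_smul c)

/-- The (physicists') Hermite polynomials: `H_0 = 1`, `H_{n+1} = 2 x H_n - H_n'`. -/
noncomputable def hermiteH : ℕ → ℝ[X]
  | 0 => 1
  | n + 1 => 2 * X * hermiteH n - derivative (hermiteH n)

/-- The Legendre polynomials, by Rodrigues' formula. -/
noncomputable def legendreP (n : ℕ) : ℝ[X] :=
  C (1 / (2 ^ n * (n.factorial : ℝ))) * derivative^[n] ((X ^ 2 - 1) ^ n)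

/-- The normalisation `(2^n n! √π)^{-1/2}`. -/
noncomputable def normConst (n : ℕ) : ℝ := 1 / √(2 ^ n * (n.factorial : ℝ) * √Real.pi)

theorem memLp_poly_mul_gauss (p : ℝ[X]) {b : ℝ} (hb : 0 < b) :
    MemLp (fun x : ℝ => ((p.eval x * Real.exp (-b * x ^ 2) : ℝ) : ℂ)) 2 volume := by
  suffices h : MemLp (fun x : ℝ => p.eval x * Real.exp (-b * x ^ 2)) 2 volume from h.ofReal
  induction p using Polynomial.induction_on' with
  | add p q hp hq =>
    refine (hp.add hq).congr_norm ?_ (Eventually.of_forall fun x => ?_)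
    · exact Continuous.aestronglyMeasurable ((Polynomial.continuous _).mul (by fun_prop))
    · simp [Polynomial.eval_add, add_mul]
  | monomial n a =>
    have hm : AEStronglyMeasurable
        (fun x : ℝ => (monomial n a).eval x * Real.exp (-b * x ^ 2)) volume := by
      apply Continuous.aestronglyMeasurable
      exact (Polynomial.continuous _).mul (by fun_prop)
    rw [memLp_two_iff_integrable_sq hm]
    have h := (integrable_rpow_mul_exp_neg_mul_sq (b := 2 * b) (by positivity)
      (s := ((2 * n : ℕ) : ℝ)) (by
        have : (0 : ℝ) ≤ ((2 * n : ℕ) : ℝ) := Nat.cast_nonneg _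
        linarith)).const_mul (a ^ 2)
    refine h.congr (Eventually.of_forall fun x => ?_)
    simp only [Real.rpow_natCast, eval_monomial]
    have : Real.exp (-(2 * b) * x ^ 2) = Real.exp (-b * x ^ 2) ^ 2 := by
      rw [← Real.exp_nat_mul]; congr 1; push_cast; ring
    rw [this]; ring

/-! ### The three families -/

/-- `e_n(x) = (2^n n! √π)^{-1/2} H_n(x) e^{-x²/2}`. -/
noncomputable def eFun (n : ℕ) (x : ℝ) : ℂ :=
  ((normConst n * (hermiteH n).eval x * Real.exp (-x ^ 2 / 2) : ℝ) : ℂ)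

/-- `x_n(x) = (2^n n! √π)^{-1/2} H_n(x) e^{-x²/4}`. -/
noncomputable def xFun (n : ℕ) (x : ℝ) : ℂ :=
  ((normConst n * (hermiteH n).eval x * Real.exp (-x ^ 2 / 4) : ℝ) : ℂ)

/-- `y_n(x) = (2^n n! √π)^{-1/2} H_n(x) e^{-3x²/4}`. -/
noncomputable def yFun (n : ℕ) (x : ℝ) : ℂ :=
  ((normConst n * (hermiteH n).eval x * Real.exp (-3 * x ^ 2 / 4) : ℝ) : ℂ)

theorem memLp_eFun (n : ℕ) : MemLp (eFun n) 2 volume := by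
  refine (memLp_congr_ae (Eventually.of_forall fun x => ?_)).mp
    (memLp_poly_mul_gauss (C (normConst n) * hermiteH n) (b := 1 / 2) (by norm_num))
  simp only [eFun, eval_mul, eval_C]
  congr 3; ring

theorem memLp_xFun (n : ℕ) : MemLp (xFun n) 2 volume := by
  refine (memLp_congr_ae (Eventually.of_forall fun x => ?_)).mp
    (memLp_poly_mul_gauss (C (normConst n) * hermiteH n) (b := 1 / 4) (by norm_num))
  simp only [xFun, eval_mul, eval_C]
  congr 3; ring

theorem memLp_yFun (n : ℕ) : MemLp (yFun n) 2 volume := by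
  refine (memLp_congr_ae (Eventually.of_forall fun x => ?_)).mp
    (memLp_poly_mul_gauss (C (normConst n) * hermiteH n) (b := 3 / 4) (by norm_num))
  simp only [yFun, eval_mul, eval_C]
  congr 3; ring

/-- The Hermite functions as vectors of `L²(ℝ)`. -/
noncomputable def eVec (n : ℕ) : L2R := (memLp_eFun n).toLp (eFun n)

/-- The vectors `x_n` of `L²(ℝ)`. -/
noncomputable def xVec (n : ℕ) : L2R := (memLp_xFun n).toLp (xFun n)

/-- The vectors `y_n` of `L²(ℝ)`. -/
noncomputable def yVec (n : ℕ) : L2R := (memLp_yFun n).toLp (yFun n)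

/-! ### The multiplication operator `T` -/

/-- The multiplier `e^{-x²/4}`. -/
noncomputable def gaussMul (x : ℝ) : ℂ := ((Real.exp (-x ^ 2 / 4) : ℝ) : ℂ)

theorem norm_gaussMul_le (x : ℝ) : ‖gaussMul x‖ ≤ 1 := by
  rw [gaussMul, Complex.norm_real, Real.norm_eq_abs, Real.abs_exp, Real.exp_le_one_iff]
  nlinarith [sq_nonneg x]

theorem norm_gaussMul_mul_le (f : ℝ → ℂ) (x : ℝ) : ‖gaussMul x * f x‖ ≤ ‖f x‖ := by
  rw [norm_mul]
  exact mul_le_of_le_one_left (norm_nonneg _) (norm_gaussMul_le x)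

theorem memLp_gaussMul (f : L2R) : MemLp (fun x => gaussMul x * f x) 2 volume := by
  have hc : Continuous gaussMul := by unfold gaussMul; fun_prop
  exact (Lp.memLp f).mono (hc.aestronglyMeasurable.mul (Lp.aestronglyMeasurable f))
    (Eventually.of_forall (norm_gaussMul_mul_le f))

/-- The bounded operator `(T f)(x) = e^{-x²/4} f(x)` on `L²(ℝ)`. -/
noncomputable def opT : L2R →L[ℂ] L2R :=
  LinearMap.mkContinuous
    { toFun := fun f => (memLp_gaussMul f).toLp _
      map_add' := by
        intro f g
        rw [← MemLp.toLp_add]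
        apply MemLp.toLp_congr
        filter_upwards [Lp.coeFn_add f g] with x hx
        simp only [hx, Pi.add_apply, mul_add]
      map_smul' := by
        intro c f
        rw [RingHom.id_apply, ← MemLp.toLp_const_smul]
        apply MemLp.toLp_congr
        filter_upwards [Lp.coeFn_smul c f] with x hx
        simp only [hx, Pi.smul_apply, smul_eq_mul]
        ring } 1 (by
    intro f
    rw [one_mul]
    apply Lp.norm_le_norm_of_ae_le
    filter_upwards [(memLp_gaussMul f).coeFn_toLp] with x hx
    simp only [LinearMap.coe_mk, AddHom.coe_mk, hx]
    exact norm_gaussMul_mul_le f x)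

theorem opT_coeFn (f : L2R) : opT f =ᵐ[volume] fun x => gaussMul x * f x :=
  (memLp_gaussMul f).coeFn_toLp

/-- `T⁻¹`, with domain the range of `T`. -/
noncomputable def opTinv : L2R →ₗ.[ℂ] L2R :=
  ((opT : L2R →ₗ[ℂ] L2R).toPMap ⊤).inverse

/-! ### The differential operators `H_1`, `H_2` -/

/-- The Schwartz functions, embedded in `L²(ℝ)`. -/
noncomputable def schwartzToL2 : 𝓢(ℝ, ℂ) →ₗ[ℂ] L2R :=
  (SchwartzMap.toLpCLM ℂ ℂ 2 (volume : Measure ℝ) : 𝓢(ℝ, ℂ) →L[ℂ] L2R)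

theorem schwartzToL2_injective : Function.Injective schwartzToL2 :=
  SchwartzMap.injective_toLp 2 (volume : Measure ℝ)

/-- The operator in `L²(ℝ)` with domain the Schwartz functions given by a linear map of the
Schwartz space into itself. -/
noncomputable def schwartzOp (A : 𝓢(ℝ, ℂ) →ₗ[ℂ] 𝓢(ℝ, ℂ)) : L2R →ₗ.[ℂ] L2R where
  domain := LinearMap.range schwartzToL2
  toFun := schwartzToL2 ∘ₗ A ∘ₗ
    (LinearEquiv.ofInjective schwartzToL2 schwartzToL2_injective).symm.toLinearMap

theorem schwartzOp_apply (A : 𝓢(ℝ, ℂ) →ₗ[ℂ] 𝓢(ℝ, ℂ)) (f : 𝓢(ℝ, ℂ)) :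
    schwartzOp A ⟨schwartzToL2 f, LinearMap.mem_range_self _ f⟩ = schwartzToL2 (A f) := by
  have : (LinearEquiv.ofInjective schwartzToL2 schwartzToL2_injective).symm
      ⟨schwartzToL2 f, LinearMap.mem_range_self _ f⟩ = f := by
    rw [LinearEquiv.symm_apply_eq]; rfl
  change schwartzToL2 (A ((LinearEquiv.ofInjective schwartzToL2 schwartzToL2_injective).symm
      ⟨schwartzToL2 f, LinearMap.mem_range_self _ f⟩)) = _
  rw [this]

/-- `d/dx` on Schwartz functions. -/
noncomputable def dS : 𝓢(ℝ, ℂ) →ₗ[ℂ] 𝓢(ℝ, ℂ) :=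
  (SchwartzMap.derivCLM ℂ ℂ : 𝓢(ℝ, ℂ) →L[ℂ] 𝓢(ℝ, ℂ))

/-- Multiplication by `x` on Schwartz functions. -/
noncomputable def mS : 𝓢(ℝ, ℂ) →ₗ[ℂ] 𝓢(ℝ, ℂ) :=
  (SchwartzMap.smulLeftCLM ℂ (fun x : ℝ => (x : ℂ)) : 𝓢(ℝ, ℂ) →L[ℂ] 𝓢(ℝ, ℂ))

theorem dS_apply (f : 𝓢(ℝ, ℂ)) (x : ℝ) : dS f x = deriv f x := rfl

theorem mS_apply (f : 𝓢(ℝ, ℂ)) (x : ℝ) : mS f x = (x : ℂ) * f x :=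
  SchwartzMap.smulLeftCLM_apply_apply (Complex.ofRealCLM.hasTemperateGrowth) f x

/-- `½ [ -d²/dx² - x d/dx + ½ (3x²/2 - 1) ]` on Schwartz functions. -/
noncomputable def formH1 : 𝓢(ℝ, ℂ) →ₗ[ℂ] 𝓢(ℝ, ℂ) :=
  (1 / 2 : ℂ) • (-(dS ∘ₗ dS) - mS ∘ₗ dS +
    (1 / 2 : ℂ) • ((3 / 2 : ℂ) • (mS ∘ₗ mS) - LinearMap.id))

/-- `½ [ -d²/dx² + x d/dx + ½ (3x²/2 + 1) ]` on Schwartz functions. -/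
noncomputable def formH2 : 𝓢(ℝ, ℂ) →ₗ[ℂ] 𝓢(ℝ, ℂ) :=
  (1 / 2 : ℂ) • (-(dS ∘ₗ dS) + mS ∘ₗ dS +
    (1 / 2 : ℂ) • ((3 / 2 : ℂ) • (mS ∘ₗ mS) + LinearMap.id))

theorem formH1_apply (f : 𝓢(ℝ, ℂ)) (x : ℝ) :
    formH1 f x = 1 / 2 * (-deriv (deriv f) x - x * deriv f x
      + 1 / 2 * (3 * (x : ℂ) ^ 2 / 2 - 1) * f x) := by
  have h : dS (dS f) x = deriv (deriv f) x := rfl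
  simp only [formH1, LinearMap.smul_apply, LinearMap.add_apply, LinearMap.sub_apply,
    LinearMap.neg_apply, LinearMap.comp_apply, LinearMap.id_apply, smul_apply,
    add_apply, sub_apply, neg_apply, smul_eq_mul, mS_apply,
    h, dS_apply]
  ring

theorem formH2_apply (f : 𝓢(ℝ, ℂ)) (x : ℝ) :
    formH2 f x = 1 / 2 * (-deriv (deriv f) x + x * deriv f x
      + 1 / 2 * (3 * (x : ℂ) ^ 2 / 2 + 1) * f x) := by
  have h : dS (dS f) x = deriv (deriv f) x := rfl
  simp only [formH2, LinearMap.smul_apply, LinearMap.add_apply,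
    LinearMap.neg_apply, LinearMap.comp_apply, LinearMap.id_apply, smul_apply,
    add_apply, neg_apply, smul_eq_mul, mS_apply,
    h, dS_apply]
  ring

/-- `H_1` as an operator in `L²(ℝ)` with domain the Schwartz functions. -/
noncomputable def opH1 : L2R →ₗ.[ℂ] L2R := schwartzOp formH1

/-- `H_2` as an operator in `L²(ℝ)` with domain the Schwartz functions. -/
noncomputable def opH2 : L2R →ₗ.[ℂ] L2R := schwartzOp formH2

end GaussHermite

open GaussHermite

namespace GaussHermite

/-! ### The three term recurrence of the Legendre polynomials -/

/-! Everything rests on `T x_n = e_n`, `T e_n = y_n` with `T` symmetric, and on the family `p(x)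
e^{-bx²}` (`polyGauss`), where `b = 1/4, 1/2, 3/4` for `x_n`, `e_n`, `y_n`. An inner product of two
such vectors is a Gaussian integral that sees only the sum of the exponents; for sum `1` it is
Hermite orthogonality (`inner_hermite`). The Parseval identity for `e_n`, with `T` moved across the
scalar product, gives the quasi-basis identities and `S_y = T²`.

For the norms, integration by parts yields a recurrence for `∫ H_n² e^{-bx²}` which, after division
by `2^n n!`, is a rescaled Legendre recurrence (`gaussInt_hermiteH_sq`). The growth of `P_n(2/√3)`
comes from factoring the generating function as `(1 - az)^{-1/2} (1 - bz)^{-1/2}` with `ab = 1`,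
from Wallis' product, and from dominated convergence (`tendsto_legendreP_div`). A basis would bound
`‖x_n‖ ‖y_n‖` by Banach–Steinhaus, which the growth forbids.

Completeness: if `f` is orthogonal to all `p(x) e^{-bx²}`, the moments of `e^{-bx²} f` vanish, so
its Fourier transform does (`eq_zero_of_forall_moment_eq_zero`). The eigenvalue equations are the
Hermite differential equation. Self-adjointness fails because `H_1` and `H_2` are not even symmetric
on test functions, as the pair `u`, `x² u` shows (`realForm_sq_mul`). -/

theorem iterate_derivative_X_mul' (n : ℕ) (f : ℝ[X]) :
    derivative^[n + 1] (X * f) = X * derivative^[n + 1] f + C ((n : ℝ) + 1) * derivative^[n] f := by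
  induction n with
  | zero => simp; ring
  | succ n ih =>
    rw [Function.iterate_succ_apply', ih]
    simp only [derivative_add, derivative_mul, derivative_X, derivative_C,
      ← Function.iterate_succ_apply' derivative]
    simp only [Nat.cast_add, Nat.cast_one, map_add, map_one]
    ring

/-- `(d/dx)^n (x² - 1)^n`. -/
noncomputable def rodrigues (n : ℕ) : ℝ[X] := derivative^[n] ((X ^ 2 - 1) ^ n)

/-- Both `h1` and `h2` involve the auxiliary polynomial `D^n (X² - 1)^(n+1)`; eliminating it leaves
the three term relation. -/
theorem rodrigues_recurrence (n : ℕ) :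
    rodrigues (n + 2) = C (2 * (2 * n + 3) : ℝ) * (X * rodrigues (n + 1))
      - C (4 * (n + 1) ^ 2 : ℝ) * rodrigues n := by
  have h1 : rodrigues (n + 2) = C (2 * (n + 2) : ℝ) * (X * rodrigues (n + 1)
      + C ((n : ℝ) + 1) * derivative^[n] ((X ^ 2 - 1) ^ (n + 1))) := by
    rw [rodrigues, Function.iterate_succ_apply]
    have : derivative ((X ^ 2 - 1 : ℝ[X]) ^ (n + 2))
        = C (2 * (n + 2) : ℝ) * (X * (X ^ 2 - 1) ^ (n + 1)) := by
      rw [derivative_pow]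
      simp only [derivative_sub, derivative_X_pow, derivative_one]
      simp
      ring
    rw [this, iterate_derivative_C_mul, iterate_derivative_X_mul', rodrigues]
  have h2 : X * rodrigues (n + 1) = C ((n : ℝ) + 2) * derivative^[n] ((X ^ 2 - 1) ^ (n + 1))
      + C (2 * (n + 1) : ℝ) * rodrigues n := by
    have e1 : derivative^[n] (X * derivative ((X ^ 2 - 1 : ℝ[X]) ^ (n + 1)))
        = X * derivative^[n + 1] ((X ^ 2 - 1) ^ (n + 1))
          + C (n : ℝ) * derivative^[n] ((X ^ 2 - 1) ^ (n + 1)) := by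
      cases n with
      | zero => simp
      | succ n =>
        rw [iterate_derivative_X_mul', ← Function.iterate_succ_apply,
          ← Function.iterate_succ_apply]
        push_cast
        rfl
    have e2 : X * derivative ((X ^ 2 - 1 : ℝ[X]) ^ (n + 1))
        = C (2 * (n + 1) : ℝ) * ((X ^ 2 - 1) ^ (n + 1) + (X ^ 2 - 1) ^ n) := by
      rw [derivative_pow]
      simp only [derivative_sub, derivative_X_pow, derivative_one]
      simp
      ring
    rw [e2, iterate_derivative_C_mul, iterate_map_add] at e1
    rw [rodrigues, rodrigues, eq_sub_of_add_eq e1.symm]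
    simp only [map_mul, map_add, map_natCast, map_ofNat, map_one]
    ring
  have h3 := congrArg (fun p => C (2 * (n + 1) : ℝ) * p) h2
  rw [h1]
  simp only [map_mul, map_add, map_natCast, map_ofNat, map_one, map_pow] at h2 h3 ⊢
  linear_combination -h3

theorem legendreP_eval_zero (t : ℝ) : (legendreP 0).eval t = 1 := by simp [legendreP]

theorem legendreP_eval_one (t : ℝ) : (legendreP 1).eval t = t := by
  simp [legendreP]
  ring

theorem legendreP_eval_eq (n : ℕ) (t : ℝ) :
    (legendreP n).eval t = (rodrigues n).eval t / (2 ^ n * n.factorial) := by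
  rw [legendreP, rodrigues, eval_mul, eval_C]; ring

theorem legendreP_recurrence (n : ℕ) (t : ℝ) :
    ((n : ℝ) + 2) * (legendreP (n + 2)).eval t =
      (2 * n + 3) * t * (legendreP (n + 1)).eval t - (n + 1) * (legendreP n).eval t := by
  have h := congrArg (eval t) (rodrigues_recurrence n)
  simp only [eval_sub, eval_mul, eval_C, eval_X] at h
  simp only [legendreP_eval_eq, h, Nat.factorial_succ]
  have : (n.factorial : ℝ) ≠ 0 := by positivity
  push_cast
  have h1 : (n : ℝ) + 1 ≠ 0 := by positivity
  have h2 : (n : ℝ) + 1 + 1 ≠ 0 := by positivity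
  field_simp
  ring

/-- The three term recurrence determines a scaled sequence of Legendre values. -/
theorem eq_legendreP_of_recurrence {u : ℕ → ℝ} {a r t : ℝ} (h0 : u 0 = a) (h1 : u 1 = a * r * t)
    (h : ∀ n : ℕ, ((n : ℝ) + 2) * u (n + 2) =
      (2 * n + 3) * (r * t) * u (n + 1) - (n + 1) * r ^ 2 * u n) (n : ℕ) :
    u n = a * r ^ n * (legendreP n).eval t := by
  induction n using Nat.strong_induction_on with
  | _ n ih =>
    match n with
    | 0 => simp [h0, legendreP_eval_zero]
    | 1 => simp [h1, legendreP_eval_one]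
    | n + 2 =>
      have hn : (n : ℝ) + 2 ≠ 0 := by positivity
      apply mul_left_cancel₀ hn
      rw [h, ih n (by omega), ih (n + 1) (by omega)]
      linear_combination (-a * r ^ (n + 2)) * legendreP_recurrence n t

/-! ### The Taylor coefficients of `(1 - z)^{-1/2}` -/

/-- The Taylor coefficients of `(1 - z)^{-1/2}`. -/
noncomputable def binomHalf (n : ℕ) : ℝ := n.centralBinom / 4 ^ n

theorem binomHalf_zero : binomHalf 0 = 1 := by simp [binomHalf]

theorem binomHalf_pos (n : ℕ) : 0 < binomHalf n := by
  have := n.centralBinom_pos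
  unfold binomHalf; positivity

theorem binomHalf_succ (n : ℕ) : (n + 1) * binomHalf (n + 1) = (n + 1 / 2) * binomHalf n := by
  have h : ((n : ℝ) + 1) * (n + 1).centralBinom = 2 * (2 * n + 1) * n.centralBinom := by
    exact_mod_cast Nat.succ_mul_centralBinom_succ n
  unfold binomHalf
  rw [← mul_div_assoc, h, pow_succ]
  field_simp
  ring

/-- The ratio of consecutive left-hand sides is the inverse of a Wallis factor. This turns Wallis'
product into the asymptotics of the central binomial coefficients. -/
theorem binomHalf_sq_mul_eq (n : ℕ) : binomHalf n ^ 2 * (2 * n + 1) = (Real.Wallis.W n)⁻¹ := by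
  induction n with
  | zero => simp [binomHalf_zero, Real.Wallis.W]
  | succ n ih =>
    have h := binomHalf_succ n
    have hn : (n : ℝ) + 1 ≠ 0 := by positivity
    have h' : binomHalf (n + 1) = (n + 1 / 2) * binomHalf n / (n + 1) := by
      rw [eq_div_iff hn]; linarith
    rw [Real.Wallis.W, Finset.prod_range_succ, ← Real.Wallis.W, mul_inv, ← ih, h']
    push_cast
    have h3 : (2 * (n : ℝ) + 3) ≠ 0 := by positivity
    have h4 : (2 * (n : ℝ) + 1) ≠ 0 := by positivity
    field_simp
    ring

theorem tendsto_sqrt_mul_binomHalf :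
    Tendsto (fun n : ℕ => √(2 * n + 1) * binomHalf n) atTop (𝓝 (√(2 / Real.pi))) := by
  have h := (Real.continuous_sqrt.tendsto _).comp
    (Real.Wallis.tendsto_W_nhds_pi_div_two.inv₀ (by positivity))
  rw [inv_div] at h
  refine h.congr fun n => ?_
  rw [Function.comp_apply, ← binomHalf_sq_mul_eq, mul_comm, Real.sqrt_mul (by positivity),
    Real.sqrt_sq (binomHalf_pos n).le]

/-- The left side decreases in `n`, since `(n + 1/2)² (n + 2) ≤ (n + 1)³`. The bound provides the
majorant for dominated convergence. -/
theorem binomHalf_sq_mul_succ_le (n : ℕ) : binomHalf n ^ 2 * (n + 1) ≤ 1 := by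
  induction n with
  | zero => simp [binomHalf_zero]
  | succ n ih =>
    have h := binomHalf_succ n
    have hn : (0 : ℝ) < (n : ℝ) + 1 := by positivity
    have h' : binomHalf (n + 1) = (n + 1 / 2) * binomHalf n / (n + 1) := by
      rw [eq_div_iff hn.ne']; linarith
    refine le_trans ?_ ih
    rw [h']
    have e : ((n + 1 / 2) * binomHalf n / (n + 1)) ^ 2 * (((n + 1 : ℕ) : ℝ) + 1)
        = binomHalf n ^ 2 * ((n + 1 / 2) ^ 2 * (n + 2) / (n + 1) ^ 2) := by
      push_cast; field_simp; ring
    rw [e]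
    gcongr
    rw [div_le_iff₀ (by positivity)]
    have : (0 : ℝ) ≤ n := n.cast_nonneg
    nlinarith

theorem binomHalf_le_one (n : ℕ) : binomHalf n ≤ 1 := by
  have h := binomHalf_sq_mul_succ_le n
  have := binomHalf_pos n
  have : (0 : ℝ) ≤ n := n.cast_nonneg
  nlinarith [sq_nonneg (binomHalf n), mul_nonneg (sq_nonneg (binomHalf n)) this]

/-- The power series of `(1 - a z)^{-1/2}`. -/
noncomputable def halfSeries (a : ℝ) : PowerSeries ℝ := PowerSeries.mk fun n => binomHalf n * a ^ n

theorem halfSeries_ode (a : ℝ) :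
    (1 - PowerSeries.C a * PowerSeries.X) * PowerSeries.derivative ℝ (halfSeries a)
      = PowerSeries.C (a / 2) * halfSeries a := by
  ext n
  rw [sub_mul, one_mul, map_sub, mul_assoc, PowerSeries.coeff_C_mul, PowerSeries.coeff_C_mul]
  cases n with
  | zero =>
    have h := binomHalf_succ 0
    simp [halfSeries, PowerSeries.coeff_derivative] at h ⊢
    rw [h]; ring
  | succ n =>
    have h := binomHalf_succ (n + 1)
    simp only [PowerSeries.coeff_succ_X_mul, PowerSeries.coeff_derivative, halfSeries,
      PowerSeries.coeff_mk]
    push_cast at h ⊢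
    linear_combination (a ^ (n + 2)) * h

/-- Since `(1 - az)(1 - bz) = 1 - 2tz + z²`, the product rule and `halfSeries_ode` give the
differential equation of the Legendre generating function. It is a formal identity, so no
convergence is involved. -/
theorem halfSeries_mul_ode {a b t : ℝ} (hab : a * b = 1) (ht : a + b = 2 * t) :
    (1 - PowerSeries.C (2 * t) * PowerSeries.X + PowerSeries.X * PowerSeries.X)
        * PowerSeries.derivative ℝ (halfSeries a * halfSeries b)
      = (PowerSeries.C t - PowerSeries.X) * (halfSeries a * halfSeries b) := by
  have e1 : (PowerSeries.C (2 * t) : PowerSeries ℝ) = PowerSeries.C a + PowerSeries.C b := by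
    rw [← map_add, ht]
  have e2 : (PowerSeries.C a : PowerSeries ℝ) * PowerSeries.C b = 1 := by
    rw [← map_mul, hab, map_one]
  have e3 : (PowerSeries.C t : PowerSeries ℝ) = PowerSeries.C (a / 2) + PowerSeries.C (b / 2) := by
    rw [← map_add]; congr 1; linarith
  have e4 : (PowerSeries.C (a / 2) : PowerSeries ℝ) * PowerSeries.C b = PowerSeries.C (1 / 2) := by
    rw [← map_mul]; congr 1; linarith
  have e5 : (PowerSeries.C (b / 2) : PowerSeries ℝ) * PowerSeries.C a = PowerSeries.C (1 / 2) := by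
    rw [← map_mul]; congr 1; linarith
  have e6 : (PowerSeries.C (1 / 2) : PowerSeries ℝ) + PowerSeries.C (1 / 2) = 1 := by
    rw [← map_add]; norm_num
  have ha := halfSeries_ode a
  have hb := halfSeries_ode b
  rw [Derivation.leibniz, smul_eq_mul, smul_eq_mul, e1, e3]
  -- With every series made an atom, the claim is a commutative ring identity modulo the hypotheses.
  generalize halfSeries a = A at *
  generalize halfSeries b = B at *
  generalize PowerSeries.derivative ℝ A = A' at *
  generalize PowerSeries.derivative ℝ B = B' at *
  generalize (PowerSeries.X : PowerSeries ℝ) = x at *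
  generalize (PowerSeries.C a : PowerSeries ℝ) = ca at *
  generalize (PowerSeries.C b : PowerSeries ℝ) = cb at *
  generalize (PowerSeries.C (a / 2) : PowerSeries ℝ) = ca2 at *
  generalize (PowerSeries.C (b / 2) : PowerSeries ℝ) = cb2 at *
  generalize (PowerSeries.C (1 / 2) : PowerSeries ℝ) = h at *
  linear_combination (1 - cb * x) * B * ha + (1 - ca * x) * A * hb
    - x * x * (A * B' + B * A') * e2 - A * B * x * (e4 + e5) - A * B * x * e6

/-- Comparing coefficients in the differential equation gives the Legendre recurrence, here with
trivial scaling. -/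
theorem coeff_halfSeries_mul {a b t : ℝ} (hab : a * b = 1) (ht : a + b = 2 * t) (n : ℕ) :
    PowerSeries.coeff n (halfSeries a * halfSeries b) = (legendreP n).eval t := by
  have hode := halfSeries_mul_ode hab ht
  have c0 : PowerSeries.coeff 0 (halfSeries a * halfSeries b) = 1 := by
    simp [PowerSeries.coeff_mul, halfSeries, binomHalf_zero]
  generalize halfSeries a * halfSeries b = F at *
  have key : ∀ n : ℕ, PowerSeries.coeff n F = 1 * 1 ^ n * (legendreP n).eval t := by
    apply eq_legendreP_of_recurrence c0
    · have h := congrArg (PowerSeries.coeff 0) hode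
      simp only [add_mul, sub_mul, one_mul, map_add, map_sub, mul_assoc, PowerSeries.coeff_C_mul,
        PowerSeries.coeff_zero_X_mul, PowerSeries.coeff_derivative, c0] at h
      simp at h
      simpa using h
    · intro n
      have h := congrArg (PowerSeries.coeff (n + 1)) hode
      simp only [add_mul, sub_mul, one_mul, map_add, map_sub, mul_assoc, PowerSeries.coeff_C_mul,
        PowerSeries.coeff_succ_X_mul, PowerSeries.coeff_derivative] at h
      cases n with
      | zero =>
        simp only [PowerSeries.coeff_zero_X_mul] at h
        push_cast at h ⊢
        linear_combination h
      | succ n =>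
        simp only [PowerSeries.coeff_succ_X_mul, PowerSeries.coeff_derivative] at h
        push_cast at h ⊢
        linear_combination h
  simpa using key n

theorem legendreP_eval_eq_sum {a b t : ℝ} (hab : a * b = 1) (ht : a + b = 2 * t) (n : ℕ) :
    (legendreP n).eval t = ∑ k ∈ Finset.range (n + 1),
      binomHalf k * a ^ k * (binomHalf (n - k) * b ^ (n - k)) := by
  rw [← coeff_halfSeries_mul hab ht, PowerSeries.coeff_mul,
    Finset.Nat.sum_antidiagonal_eq_sum_range_succ_mk]
  simp [halfSeries]

theorem legendreP_eval_at_one (n : ℕ) : (legendreP n).eval 1 = 1 := by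
  induction n using Nat.strong_induction_on with
  | _ n ih =>
    match n with
    | 0 => simp [legendreP_eval_zero]
    | 1 => simp [legendreP_eval_one]
    | n + 2 =>
      have h := legendreP_recurrence n 1
      have hn : (n : ℝ) + 2 ≠ 0 := by positivity
      rw [ih n (by omega), ih (n + 1) (by omega)] at h
      apply mul_left_cancel₀ hn
      rw [h]; ring

theorem summable_binomHalf_mul_pow {r : ℝ} (h0 : 0 ≤ r) (h1 : r < 1) :
    Summable fun n => binomHalf n * r ^ n :=
  (summable_geometric_of_lt_one h0 h1).of_nonneg_of_le
    (fun n => mul_nonneg (binomHalf_pos n).le (pow_nonneg h0 n))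
    fun n => mul_le_of_le_one_left (pow_nonneg h0 n) (binomHalf_le_one n)

/-- The Cauchy square of the series is the geometric series: its coefficients are `P_n(1) = 1`, by
`legendreP_eval_eq_sum` with `a = b = 1`. -/
theorem tsum_binomHalf_mul_pow {r : ℝ} (h0 : 0 ≤ r) (h1 : r < 1) :
    ∑' n, binomHalf n * r ^ n = √(1 - r)⁻¹ := by
  have hs := summable_binomHalf_mul_pow h0 h1
  have hpos : 0 ≤ ∑' n, binomHalf n * r ^ n :=
    tsum_nonneg fun n => mul_nonneg (binomHalf_pos n).le (pow_nonneg h0 n)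
  have h := tsum_mul_tsum_eq_tsum_sum_antidiagonal_of_summable_norm hs.norm hs.norm
  symm
  rw [Real.sqrt_eq_iff_mul_self_eq (inv_nonneg.mpr (by linarith)) hpos, h,
    ← tsum_geometric_of_lt_one h0 h1]
  congr 1
  ext n
  rw [← mul_one (r ^ n), ← legendreP_eval_at_one n,
    legendreP_eval_eq_sum (a := 1) (b := 1) (by norm_num) (by norm_num),
    Finset.Nat.sum_antidiagonal_eq_sum_range_succ_mk, Finset.mul_sum]
  refine Finset.sum_congr rfl fun k hk => ?_
  have : n = k + (n - k) := by have := Finset.mem_range.mp hk; omega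
  have hp : r ^ n = r ^ k * r ^ (n - k) := by rw [← pow_add, ← this]
  rw [hp]
  simp
  ring

/-! ### Growth of the Legendre polynomials at `2/√3` -/

/-- For `t = 2/√3` the roots are `1/√3` and `√3`, so `P_n(t) / √3 ^ n` is a convolution of
`binomHalf (n - k)` with the summable weights `binomHalf k * (1/3)^k`. Each `√(2n+1) * binomHalf (n
- k)` tends to `√(2/π)`, and the weights sum to `√(3/2)`. -/
theorem tendsto_legendreP_div :
    Tendsto (fun n : ℕ => √(2 * n + 1) * ((legendreP n).eval (2 / √3) / √3 ^ n)) atTop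
      (𝓝 (√(2 / Real.pi) * √(3 / 2))) := by
  have h3 : √(3 : ℝ) ≠ 0 := by positivity
  have hsq : √(3 : ℝ) ^ 2 = 3 := Real.sq_sqrt (by norm_num)
  have hsum : ∑' k : ℕ, √(2 / Real.pi) * (binomHalf k * (1 / 3) ^ k)
      = √(2 / Real.pi) * √(3 / 2) := by
    rw [tsum_mul_left, tsum_binomHalf_mul_pow (by norm_num) (by norm_num)]
    norm_num
  rw [← hsum]
  let F : ℕ → ℕ → ℝ := fun n k => if k ∈ Finset.range (n + 1) then
    √(2 * n + 1) * binomHalf (n - k) * (binomHalf k * (1 / 3) ^ k) else 0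
  have hF : ∀ n : ℕ, ∑' k, F n k = √(2 * n + 1) * ((legendreP n).eval (2 / √3) / √3 ^ n) := by
    intro n
    rw [tsum_eq_sum (s := Finset.range (n + 1)) (fun k hk => if_neg hk),
      legendreP_eval_eq_sum (a := 1 / √3) (b := √3) (by field_simp)
        (by field_simp; rw [hsq]; norm_num), Finset.sum_div, Finset.mul_sum]
    refine Finset.sum_congr rfl fun k hk => ?_
    rw [if_pos hk]
    have hk' : n = k + (n - k) := by have := Finset.mem_range.mp hk; omega
    have hp : √(3 : ℝ) ^ n = √3 ^ k * √3 ^ (n - k) := by rw [← pow_add, ← hk']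
    have hp3 : (1 / 3 : ℝ) ^ k = (1 / √3) ^ k * (1 / √3) ^ k := by
      rw [← mul_pow]; congr 1; field_simp; rw [hsq]
    rw [hp, hp3]
    simp only [one_div, inv_pow]
    field_simp
  simp_rw [← hF]
  -- The majorant: with `n = k + m`, `2n + 1 ≤ (m + 1) * 2(k + 1)`, and `binomHalf_sq_mul_succ_le`
  -- absorbs the factor `m + 1`.
  have hb : Summable fun k : ℕ => 2 * ((k + 1 : ℝ) * (1 / 3) ^ k) := by
    apply Summable.mul_left
    simp_rw [add_mul, one_mul]
    refine Summable.add ?_ (summable_geometric_of_lt_one (by norm_num) (by norm_num))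
    simpa using summable_pow_mul_geometric_of_norm_lt_one 1 (r := (1 / 3 : ℝ)) (by norm_num)
  refine tendsto_tsum_of_dominated_convergence hb (fun k => ?_) (Eventually.of_forall fun n k => ?_)
  · have hk : Tendsto (fun n : ℕ => √(2 * n + 1) * binomHalf (n - k)) atTop
        (𝓝 (√(2 / Real.pi))) := by
      -- The correction factor after shifting `n` by `k`.
      have hr : Tendsto (fun n : ℕ => √((2 * (n + k : ℕ) + 1) / (2 * n + 1) : ℝ)) atTop (𝓝 1) := by
        rw [← Real.sqrt_one]
        refine (Real.continuous_sqrt.tendsto _).comp ?_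
        have : Tendsto (fun n : ℕ => 1 + 2 * (k : ℝ) / (2 * n + 1)) atTop (𝓝 (1 + 0)) := by
          refine tendsto_const_nhds.add (tendsto_const_nhds.div_atTop ?_)
          refine Tendsto.atTop_add ?_ tendsto_const_nhds
          exact tendsto_natCast_atTop_atTop.const_mul_atTop two_pos
        rw [add_zero] at this
        refine this.congr fun n => ?_
        have : (2 * (n : ℝ) + 1) ≠ 0 := by positivity
        field_simp
        push_cast
        ring
      have h := hr.mul tendsto_sqrt_mul_binomHalf
      rw [one_mul] at h
      rw [← tendsto_add_atTop_iff_nat k]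
      refine h.congr fun n => ?_
      rw [← mul_assoc, ← Real.sqrt_mul (by positivity), div_mul_cancel₀ _ (by positivity)]
      simp
    refine (hk.mul_const _).congr' ?_
    filter_upwards [eventually_ge_atTop k] with n hn
    simp only [F]
    rw [if_pos (Finset.mem_range.mpr (by omega))]
  · by_cases hk : k ∈ Finset.range (n + 1)
    · simp only [F, if_pos hk]
      have hk' : n = k + (n - k) := by have := Finset.mem_range.mp hk; omega
      set m := n - k
      have hg0 := binomHalf_pos m
      have hk0 := binomHalf_pos k
      rw [Real.norm_of_nonneg (by positivity), ← mul_assoc, ← mul_assoc]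
      refine mul_le_mul_of_nonneg_right ?_ (by positivity)
      refine (mul_le_of_le_one_right (mul_nonneg (Real.sqrt_nonneg _) hg0.le)
        (binomHalf_le_one k)).trans ?_
      apply abs_le_of_sq_le_sq' _ (by positivity) |>.2
      rw [mul_pow, Real.sq_sqrt (by positivity)]
      have hmg := binomHalf_sq_mul_succ_le m
      have hkk : (0 : ℝ) ≤ k := k.cast_nonneg
      have hmm : (0 : ℝ) ≤ m := m.cast_nonneg
      have hn : (n : ℝ) = k + m := by exact_mod_cast hk'
      have h1 : (2 * (n : ℝ) + 1) ≤ (m + 1) * (2 * (k + 1)) := by rw [hn]; nlinarith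
      calc (2 * (n : ℝ) + 1) * binomHalf m ^ 2
          ≤ (m + 1) * (2 * (k + 1)) * binomHalf m ^ 2 := by gcongr
        _ = (binomHalf m ^ 2 * (m + 1)) * (2 * (k + 1)) := by ring
        _ ≤ 1 * (2 * (k + 1)) := by gcongr
        _ ≤ (2 * ((k : ℝ) + 1)) ^ 2 := by nlinarith
    · simp only [F, if_neg hk, norm_zero]
      positivity

theorem legendreP_sq_isEquivalent :
    (fun n : ℕ => 2 / √3 * (legendreP n).eval (2 / √3) ^ 2) ~[atTop]
      fun n : ℕ => √3 / Real.pi * ((3 : ℝ) ^ n / n) := by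
  have hsq : √(3 : ℝ) ^ 2 = 3 := Real.sq_sqrt (by norm_num)
  have h3 : √(3 : ℝ) ≠ 0 := by positivity
  rw [Asymptotics.isEquivalent_iff_tendsto_one]
  · have h := (tendsto_legendreP_div.pow 2)
    rw [← Real.sqrt_mul (by positivity), Real.sq_sqrt (by positivity)] at h
    have hr : Tendsto (fun n : ℕ => (n : ℝ) / (2 * n + 1)) atTop (𝓝 (1 / 2)) := by
      have : Tendsto (fun n : ℕ => 1 / 2 - (1 / 2) / (2 * (n : ℝ) + 1)) atTop (𝓝 (1 / 2 - 0)) := by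
        refine tendsto_const_nhds.sub (tendsto_const_nhds.div_atTop ?_)
        refine Tendsto.atTop_add ?_ tendsto_const_nhds
        exact tendsto_natCast_atTop_atTop.const_mul_atTop two_pos
      rw [sub_zero] at this
      refine this.congr fun n => ?_
      have : (2 * (n : ℝ) + 1) ≠ 0 := by positivity
      field_simp
      ring
    -- The constant is the quotient of `2/√3` by `√3/π`, the prefactors of the two sides.
    have h' := (h.mul hr).const_mul (2 * Real.pi / 3)
    have e : 2 * Real.pi / 3 * (2 / Real.pi * (3 / 2) * (1 / 2)) = 1 := by
      have := Real.pi_ne_zero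
      field_simp
    rw [e] at h'
    refine h'.congr' ?_
    filter_upwards [eventually_gt_atTop 0] with n hn
    have hn' : (n : ℝ) ≠ 0 := by positivity
    have hp : (√(3 : ℝ) ^ n) ^ 2 = 3 ^ n := by rw [← pow_mul, mul_comm, pow_mul, hsq]
    rw [Pi.div_apply, mul_pow, Real.sq_sqrt (by positivity), div_pow, hp]
    have := Real.pi_ne_zero
    field_simp
    rw [hsq]
  · filter_upwards [eventually_gt_atTop 0] with n hn
    have hn' : (0 : ℝ) < n := by exact_mod_cast hn
    positivity

theorem tendsto_three_pow_div_atTop :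
    Tendsto (fun n : ℕ => √3 / Real.pi * ((3 : ℝ) ^ n / n)) atTop atTop := by
  refine Tendsto.const_mul_atTop (by positivity) ?_
  have h := tendsto_pow_const_div_const_pow_of_one_lt 1 (r := (3 : ℝ)) (by norm_num)
  have h' : Tendsto (fun n : ℕ => (n : ℝ) ^ 1 / 3 ^ n) atTop (𝓝[>] 0) := by
    rw [tendsto_nhdsWithin_iff]
    refine ⟨h, ?_⟩
    filter_upwards [eventually_gt_atTop 0] with n hn
    have hn' : (0 : ℝ) < n := by exact_mod_cast hn
    simp only [Set.mem_Ioi]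
    positivity
  refine (tendsto_inv_nhdsGT_zero.comp h').congr fun n => ?_
  simp

/-! ### Gaussian integrals of polynomials -/

theorem integrable_poly_mul_gauss (p : ℝ[X]) {b : ℝ} (hb : 0 < b) :
    Integrable (fun x : ℝ => p.eval x * Real.exp (-b * x ^ 2)) := by
  induction p using Polynomial.induction_on' with
  | add p q hp hq =>
    refine (hp.add hq).congr (Eventually.of_forall fun x => ?_)
    simp [Polynomial.eval_add, add_mul]
  | monomial n a =>
    have h := (integrable_rpow_mul_exp_neg_mul_sq hb (s := (n : ℝ)) (by
      have : (0 : ℝ) ≤ n := Nat.cast_nonneg _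
      linarith)).const_mul a
    refine h.congr (Eventually.of_forall fun x => ?_)
    simp [eval_monomial, mul_assoc]

/-- `∫ p(x) e^{-b x²} dx`. -/
noncomputable def gaussInt (b : ℝ) (p : ℝ[X]) : ℝ := ∫ x : ℝ, p.eval x * Real.exp (-b * x ^ 2)

theorem gaussInt_one (b : ℝ) : gaussInt b 1 = √(Real.pi / b) := by
  simpa [gaussInt] using integral_gaussian b

theorem gaussInt_add {b : ℝ} (hb : 0 < b) (p q : ℝ[X]) :
    gaussInt b (p + q) = gaussInt b p + gaussInt b q := by
  simp only [gaussInt, eval_add, add_mul]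
  exact integral_add (integrable_poly_mul_gauss p hb) (integrable_poly_mul_gauss q hb)

theorem gaussInt_sub {b : ℝ} (hb : 0 < b) (p q : ℝ[X]) :
    gaussInt b (p - q) = gaussInt b p - gaussInt b q := by
  simp only [gaussInt, eval_sub, sub_mul]
  exact integral_sub (integrable_poly_mul_gauss p hb) (integrable_poly_mul_gauss q hb)

theorem gaussInt_C_mul (b a : ℝ) (p : ℝ[X]) : gaussInt b (C a * p) = a * gaussInt b p := by
  simp only [gaussInt, eval_mul, eval_C, mul_assoc]
  exact integral_const_mul _ _

theorem hasDerivAt_poly_mul_gauss (p : ℝ[X]) (b x : ℝ) :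
    HasDerivAt (fun x : ℝ => p.eval x * Real.exp (-b * x ^ 2))
      ((derivative p - C (2 * b) * (X * p)).eval x * Real.exp (-b * x ^ 2)) x := by
  have h := (p.hasDerivAt x).mul (((hasDerivAt_pow 2 x).const_mul (-b)).exp)
  refine h.congr_deriv ?_
  simp
  ring

/-- Integration by parts. -/
theorem gaussInt_derivative {b : ℝ} (hb : 0 < b) (p : ℝ[X]) :
    gaussInt b (derivative p) = 2 * b * gaussInt b (X * p) := by
  have h := integral_eq_zero_of_hasDerivAt_of_integrable (hasDerivAt_poly_mul_gauss p b)
    (integrable_poly_mul_gauss _ hb) (integrable_poly_mul_gauss _ hb)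
  change gaussInt b (derivative p - C (2 * b) * (X * p)) = 0 at h
  rw [gaussInt_sub hb, gaussInt_C_mul] at h
  linarith

/-! ### Hermite polynomials -/

theorem hermiteH_zero : hermiteH 0 = 1 := rfl

theorem hermiteH_succ (n : ℕ) :
    hermiteH (n + 1) = 2 * X * hermiteH n - derivative (hermiteH n) := rfl

theorem derivative_hermiteH_succ (n : ℕ) :
    derivative (hermiteH (n + 1)) = C (2 * (n + 1) : ℝ) * hermiteH n := by
  induction n with
  | zero =>
    simp [hermiteH_succ, hermiteH_zero, show (2 : ℝ[X]) = C 2 from rfl]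
  | succ n ih =>
    rw [hermiteH_succ (n + 1), derivative_sub, derivative_mul, ih, derivative_C_mul,
      derivative_mul, derivative_X, show (2 : ℝ[X]) = C 2 from rfl, derivative_C]
    have h := hermiteH_succ n
    rw [show (2 : ℝ[X]) = C 2 from rfl] at h
    simp only [map_mul, map_add, map_one, Nat.cast_add, Nat.cast_one]
    rw [h]
    ring

theorem hermiteH_ode (n : ℕ) :
    derivative (derivative (hermiteH n)) =
      2 * X * derivative (hermiteH n) - C (2 * n : ℝ) * hermiteH n := by
  have h := derivative_hermiteH_succ n
  rw [hermiteH_succ, derivative_sub, derivative_mul, derivative_mul, derivative_X,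
    show (2 : ℝ[X]) = C 2 from rfl, derivative_C] at h
  rw [show (2 : ℝ[X]) = C 2 from rfl]
  simp only [map_mul, map_add, map_one] at h ⊢
  linear_combination -h

/-- The term `2x H_n` of the Hermite recurrence is integrated by parts. At `b = 1` the first summand
drops out, so `H_n ↦ H_{n+1}` is dual to differentiation, whence orthogonality. -/
theorem gaussInt_hermiteH_succ_mul {b : ℝ} (hb : 0 < b) (n : ℕ) (p : ℝ[X]) :
    b * gaussInt b (hermiteH (n + 1) * p) =
      (1 - b) * gaussInt b (derivative (hermiteH n) * p) +
        gaussInt b (hermiteH n * derivative p) := by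
  have h := gaussInt_derivative hb (hermiteH n * p)
  rw [derivative_mul, gaussInt_add hb] at h
  have e : hermiteH (n + 1) * p = C 2 * (X * (hermiteH n * p)) - derivative (hermiteH n) * p := by
    rw [hermiteH_succ, show (2 : ℝ[X]) = C 2 from rfl]; ring
  rw [e, gaussInt_sub hb, gaussInt_C_mul]
  linarith

theorem gaussInt_hermiteH_mul_hermiteH (n m : ℕ) :
    gaussInt 1 (hermiteH n * hermiteH m) =
      if n = m then 2 ^ n * (n.factorial : ℝ) * √Real.pi else 0 := by
  have key (n : ℕ) (p : ℝ[X]) : gaussInt 1 (hermiteH (n + 1) * p)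
      = gaussInt 1 (hermiteH n * derivative p) := by
    have h := gaussInt_hermiteH_succ_mul one_pos n p
    linarith
  have hz : gaussInt 1 0 = 0 := by simp [gaussInt]
  induction n generalizing m with
  | zero =>
    cases m with
    | zero => simp [hermiteH_zero, gaussInt_one]
    | succ m => rw [mul_comm, key, hermiteH_zero, derivative_one, mul_zero, hz]; simp
  | succ n ih =>
    cases m with
    | zero => rw [key, hermiteH_zero, derivative_one, mul_zero, hz]; simp
    | succ m =>
      rw [key, derivative_hermiteH_succ, mul_left_comm, gaussInt_C_mul, ih]
      by_cases h : n = m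
      · subst h
        simp only [if_true, Nat.factorial_succ]
        push_cast
        ring
      · simp [h]

/-- For `b ≠ 1` the off-diagonal integrals `∫ H_n' H_{n+1} e^{-bx²}` enter. They satisfy their own
recurrence `off` and are eliminated using `diag` at `n` and `n + 1`. -/
theorem gaussInt_hermiteH_sq_recurrence {b : ℝ} (hb : 0 < b) (n : ℕ) :
    b * gaussInt b (hermiteH (n + 2) * hermiteH (n + 2)) =
      2 * (2 * n + 3) * gaussInt b (hermiteH (n + 1) * hermiteH (n + 1))
        - 4 * (n + 1) ^ 2 * (2 - b) * gaussInt b (hermiteH n * hermiteH n) := by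
  have diag (n : ℕ) : b * gaussInt b (hermiteH (n + 1) * hermiteH (n + 1)) =
      (1 - b) * gaussInt b (derivative (hermiteH n) * hermiteH (n + 1))
        + 2 * (n + 1) * gaussInt b (hermiteH n * hermiteH n) := by
    rw [gaussInt_hermiteH_succ_mul hb, derivative_hermiteH_succ, mul_left_comm (hermiteH n),
      gaussInt_C_mul]
  have off : b * gaussInt b (derivative (hermiteH (n + 1)) * hermiteH (n + 2)) =
      2 * (n + 1) * (2 * (n + 1) * (1 - b) * gaussInt b (hermiteH n * hermiteH n)
        + gaussInt b (derivative (hermiteH n) * hermiteH (n + 1))) := by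
    have h := gaussInt_hermiteH_succ_mul hb (n + 1) (hermiteH n)
    rw [derivative_hermiteH_succ, mul_assoc, gaussInt_C_mul] at h
    rw [derivative_hermiteH_succ, mul_assoc, gaussInt_C_mul, mul_comm (hermiteH n),
      mul_comm (derivative (hermiteH n))]
    linear_combination 2 * ((n : ℝ) + 1) * h
  have h1 := diag n
  have h2 := diag (n + 1)
  push_cast at h2
  apply mul_left_cancel₀ hb.ne'
  linear_combination b * h2 + (1 - b) * off - 2 * ((n : ℝ) + 1) * h1

theorem gaussInt_hermiteH_sq {b r t : ℝ} (hb : 0 < b) (hrt : b * (r * t) = 1)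
    (hr : b * r ^ 2 = 2 - b) (n : ℕ) :
    gaussInt b (hermiteH n * hermiteH n) / (2 ^ n * (n.factorial : ℝ)) =
      √(Real.pi / b) * r ^ n * (legendreP n).eval t := by
  have hrt' : r * t = 1 / b := by field_simp; linarith
  have hr' : r ^ 2 = (2 - b) / b := by field_simp; linarith
  refine eq_legendreP_of_recurrence
    (u := fun n => gaussInt b (hermiteH n * hermiteH n) / (2 ^ n * (n.factorial : ℝ)))
    ?_ ?_ (fun n => ?_) n
  · simp [hermiteH_zero, gaussInt_one]
  · have h := gaussInt_hermiteH_succ_mul hb 0 (hermiteH 1)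
    rw [derivative_hermiteH_succ, mul_left_comm, gaussInt_C_mul, hermiteH_zero] at h
    have hz : gaussInt b 0 = 0 := by simp [gaussInt]
    simp [gaussInt_one, hz] at h
    rw [mul_assoc, hrt']
    simp only [Nat.factorial_one, pow_one, Nat.cast_one, mul_one]
    field_simp
    rw [mul_comm, h, mul_comm]
  · have h := gaussInt_hermiteH_sq_recurrence hb n
    have h' : gaussInt b (hermiteH (n + 2) * hermiteH (n + 2)) =
      (2 * (2 * n + 3) * gaussInt b (hermiteH (n + 1) * hermiteH (n + 1))
        - 4 * (n + 1) ^ 2 * (2 - b) * gaussInt b (hermiteH n * hermiteH n)) / b := by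
      rw [eq_div_iff hb.ne', ← h]; ring
    simp only [hrt', hr', h', Nat.factorial_succ]
    have : (n.factorial : ℝ) ≠ 0 := by positivity
    push_cast
    have h1 : (n : ℝ) + 1 ≠ 0 := by positivity
    have h2 : (n : ℝ) + 1 + 1 ≠ 0 := by positivity
    field_simp
    ring

/-! ### Polynomials times Gaussians as vectors of `L²(ℝ)` -/

/-- The vector `p(x) e^{-b x²}` of `L²(ℝ)`. -/
noncomputable def polyGauss (p : ℝ[X]) (b : ℝ) (hb : 0 < b) : L2R :=
  (memLp_poly_mul_gauss p hb).toLp _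

theorem polyGauss_coeFn (p : ℝ[X]) {b : ℝ} (hb : 0 < b) :
    polyGauss p b hb =ᵐ[volume] fun x => ((p.eval x * Real.exp (-b * x ^ 2) : ℝ) : ℂ) :=
  (memLp_poly_mul_gauss p hb).coeFn_toLp

theorem inner_polyGauss (p q : ℝ[X]) {b c : ℝ} (hb : 0 < b) (hc : 0 < c) :
    inner ℂ (polyGauss p b hb) (polyGauss q c hc) = (gaussInt (b + c) (p * q) : ℂ) := by
  rw [L2.inner_def, gaussInt, ← integral_complex_ofReal]
  refine integral_congr_ae ?_
  filter_upwards [polyGauss_coeFn p hb, polyGauss_coeFn q hc] with x h1 h2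
  rw [h1, h2, RCLike.inner_apply, Complex.conj_ofReal,
    ← Complex.ofReal_mul]
  congr 1
  rw [eval_mul, show -(b + c) * x ^ 2 = -b * x ^ 2 + -c * x ^ 2 by ring, Real.exp_add]
  ring

theorem norm_polyGauss_sq (p : ℝ[X]) {b : ℝ} (hb : 0 < b) :
    ‖polyGauss p b hb‖ ^ 2 = gaussInt (b + b) (p * p) := by
  have h := inner_polyGauss p p hb hb
  rw [inner_self_eq_norm_sq_to_K] at h
  apply Complex.ofReal_injective
  rw [← h]
  push_cast
  rfl

/-- The normalised Hermite polynomial. -/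
noncomputable def hermiteN (n : ℕ) : ℝ[X] := C (normConst n) * hermiteH n

theorem eVec_eq (n : ℕ) : eVec n = polyGauss (hermiteN n) (1 / 2) (by norm_num) := by
  refine MemLp.toLp_congr _ _ (Eventually.of_forall fun x => ?_)
  simp only [eFun, hermiteN, eval_mul, eval_C]
  congr 3; ring

theorem xVec_eq (n : ℕ) : xVec n = polyGauss (hermiteN n) (1 / 4) (by norm_num) := by
  refine MemLp.toLp_congr _ _ (Eventually.of_forall fun x => ?_)
  simp only [xFun, hermiteN, eval_mul, eval_C]
  congr 3; ring

theorem yVec_eq (n : ℕ) : yVec n = polyGauss (hermiteN n) (3 / 4) (by norm_num) := by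
  refine MemLp.toLp_congr _ _ (Eventually.of_forall fun x => ?_)
  simp only [yFun, hermiteN, eval_mul, eval_C]
  congr 3; ring

theorem normConst_pos (n : ℕ) : 0 < normConst n := by
  have := Real.pi_pos
  unfold normConst; positivity

theorem normConst_sq (n : ℕ) :
    normConst n * normConst n = 1 / (2 ^ n * (n.factorial : ℝ) * √Real.pi) := by
  unfold normConst
  rw [div_mul_div_comm, Real.mul_self_sqrt (by positivity), one_mul]

theorem gaussInt_hermiteN_mul (b : ℝ) (n m : ℕ) : gaussInt b (hermiteN n * hermiteN m) =
    normConst n * normConst m * gaussInt b (hermiteH n * hermiteH m) := by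
  rw [← gaussInt_C_mul, map_mul, hermiteN, hermiteN]
  congr 1; ring

theorem inner_hermite {b c : ℝ} (hb : 0 < b) (hc : 0 < c) (h : b + c = 1) (n m : ℕ) :
    inner ℂ (polyGauss (hermiteN n) b hb) (polyGauss (hermiteN m) c hc) =
      if n = m then (1 : ℂ) else 0 := by
  rw [inner_polyGauss, h, gaussInt_hermiteN_mul, gaussInt_hermiteH_mul_hermiteH]
  by_cases hnm : n = m
  · subst hnm
    have := Real.pi_pos
    have hne : 2 ^ n * (n.factorial : ℝ) * √Real.pi ≠ 0 := by positivity
    rw [if_pos rfl, if_pos rfl, normConst_sq, one_div_mul_cancel hne, Complex.ofReal_one]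
  · simp [hnm]

theorem isBiorthogonal_xVec_yVec : IsBiorthogonal xVec yVec := fun n m => by
  rw [xVec_eq, yVec_eq, inner_hermite _ _ (by norm_num)]

theorem orthonormal_eVec : Orthonormal ℂ eVec := by
  rw [orthonormal_iff_ite]
  intro n m
  rw [eVec_eq, eVec_eq, inner_hermite _ _ (by norm_num)]

theorem norm_sq_hermite {b r t : ℝ} (hb : 0 < b) (hrt : (b + b) * (r * t) = 1)
    (hr : (b + b) * r ^ 2 = 2 - (b + b)) (n : ℕ) :
    ‖polyGauss (hermiteN n) b hb‖ ^ 2 = √(1 / (b + b)) * r ^ n * (legendreP n).eval t := by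
  have hp : √Real.pi ≠ 0 := by have := Real.pi_pos; positivity
  have h := gaussInt_hermiteH_sq (add_pos hb hb) hrt hr n
  rw [norm_polyGauss_sq, gaussInt_hermiteN_mul, normConst_sq]
  have e : √(Real.pi / (b + b)) = √Real.pi * √(1 / (b + b)) := by
    rw [← Real.sqrt_mul (by positivity)]; congr 1; ring
  rw [e] at h
  calc _ = gaussInt (b + b) (hermiteH n * hermiteH n) / (2 ^ n * n.factorial) / √Real.pi := by
        field_simp
    _ = _ := by rw [h]; field_simp

theorem norm_sq_yVec (n : ℕ) :
    ‖yVec n‖ ^ 2 = √(2 / 3) * (1 / √3 ^ n) * (legendreP n).eval (2 / √3) := by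
  have hsq : √(3 : ℝ) ^ 2 = 3 := Real.sq_sqrt (by norm_num)
  have h3 : √(3 : ℝ) ≠ 0 := by positivity
  rw [yVec_eq, norm_sq_hermite (r := 1 / √3) (t := 2 / √3), one_div_pow]
  · norm_num
  · field_simp; rw [hsq]; norm_num
  · rw [div_pow, hsq]; norm_num

theorem norm_sq_xVec (n : ℕ) :
    ‖xVec n‖ ^ 2 = √2 * √3 ^ n * (legendreP n).eval (2 / √3) := by
  have hsq : √(3 : ℝ) ^ 2 = 3 := Real.sq_sqrt (by norm_num)
  have h3 : √(3 : ℝ) ≠ 0 := by positivity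
  rw [xVec_eq, norm_sq_hermite (r := √3) (t := 2 / √3)]
  · norm_num
  · field_simp; norm_num
  · rw [hsq]; norm_num

theorem norm_sq_mul_norm_sq (n : ℕ) :
    ‖yVec n‖ ^ 2 * ‖xVec n‖ ^ 2 = 2 / √3 * (legendreP n).eval (2 / √3) ^ 2 := by
  have h3 : √(3 : ℝ) ≠ 0 := by positivity
  have hs : √(2 : ℝ) * √2 = 2 := Real.mul_self_sqrt (by norm_num)
  rw [norm_sq_yVec, norm_sq_xVec, Real.sqrt_div (by norm_num)]
  field_simp
  rw [sq, hs]

theorem norm_sq_mul_norm_sq_isEquivalent :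
    (fun n : ℕ => ‖yVec n‖ ^ 2 * ‖xVec n‖ ^ 2) ~[atTop]
      fun n : ℕ => √3 / Real.pi * ((3 : ℝ) ^ n / n) := by
  simpa only [norm_sq_mul_norm_sq] using legendreP_sq_isEquivalent

theorem not_bddAbove_norm_mul_norm :
    ¬ BddAbove (Set.range fun n : ℕ => ‖yVec n‖ * ‖xVec n‖) := by
  rintro ⟨K, hK⟩
  have h := norm_sq_mul_norm_sq_isEquivalent.symm.tendsto_atTop tendsto_three_pow_div_atTop
  obtain ⟨n, hn⟩ := (h.eventually_gt_atTop (K ^ 2)).exists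
  have h1 : ‖yVec n‖ * ‖xVec n‖ ≤ K := hK ⟨n, rfl⟩
  have h2 : 0 ≤ ‖yVec n‖ * ‖xVec n‖ := by positivity
  nlinarith

/-! ### Injectivity of the Fourier transform -/

open scoped FourierTransform in
-- Any test function `g` is the Fourier transform of a Schwartz function `φ`, and moving the
-- transform across the integral gives `∫ g F = ∫ φ F̂ = 0`.
theorem ae_eq_zero_of_fourier_eq_zero {F : ℝ → ℂ} (hF : Integrable F)
    (h : ∀ w : ℝ, ∫ v : ℝ, Real.fourierChar (-(v * w)) • F v = 0) : ∀ᵐ x, F x = 0 := by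
  apply ae_eq_zero_of_integral_contDiff_smul_eq_zero hF.locallyIntegrable
  intro g hg hc
  have hg₁ : HasCompactSupport (Complex.ofRealCLM ∘ g) := hc.comp_left rfl
  have hg₂ : ContDiff ℝ ∞ (Complex.ofRealCLM ∘ g) := Complex.ofRealCLM.contDiff.comp hg
  set φ : 𝓢(ℝ, ℂ) := 𝓕⁻ (hg₁.toSchwartzMap hg₂)
  have hφ' : 𝓕 φ = hg₁.toSchwartzMap hg₂ := FourierTransform.fourier_fourierInv_eq _
  have key := VectorFourier.integral_fourierIntegral_smul_eq_flip (e := Real.fourierChar)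
    (L := innerₗ ℝ) (μ := volume) (ν := volume) Real.continuous_fourierChar
    continuous_inner hF φ.integrable
  have h0 : ∀ w, VectorFourier.fourierIntegral Real.fourierChar volume (innerₗ ℝ) F w = 0 := by
    intro w
    rw [← h w]
    simp [VectorFourier.fourierIntegral, mul_comm]
  simp only [h0, zero_smul, integral_zero] at key
  rw [key]
  refine integral_congr_ae (Eventually.of_forall fun x => ?_)
  have h1 : VectorFourier.fourierIntegral Real.fourierChar volume (innerₗ ℝ).flip φ x = 𝓕 φ x := by
    rw [SchwartzMap.fourier_coe, flip_innerₗ]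
    rfl
  simp only [h1, hφ', smul_eq_mul, Complex.real_smul]
  rw [mul_comm]
  rfl

/-! ### Completeness of polynomials times Gaussians -/

theorem memLp_exp_mul_abs_mul_gauss (c : ℝ) {b : ℝ} (hb : 0 < b) :
    MemLp (fun x : ℝ => Real.exp (c * |x|) * Real.exp (-b * x ^ 2)) 2 volume := by
  -- Completing the square: `c|x| - bx² ≤ c²/(2b) - bx²/2`.
  have h := (memLp_poly_mul_gauss (C (Real.exp (c ^ 2 / (2 * b)))) (half_pos hb))
  refine h.mono (by fun_prop) (Eventually.of_forall fun x => ?_)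
  rw [Complex.norm_real, eval_C, ← Real.exp_add, ← Real.exp_add, Real.norm_eq_abs,
    Real.norm_eq_abs, Real.abs_exp, Real.abs_exp, Real.exp_le_exp, ← sq_abs x]
  have e : c ^ 2 / (2 * b) + -(b / 2) * |x| ^ 2 - (c * |x| + -b * |x| ^ 2)
      = (c - b * |x|) ^ 2 / (2 * b) := by field_simp; ring
  have : 0 ≤ (c - b * |x|) ^ 2 / (2 * b) := by positivity
  linarith

theorem integrable_exp_mul_abs_mul_gauss_mul (f : L2R) (c : ℝ) {b : ℝ} (hb : 0 < b) :
    Integrable (fun x : ℝ => ((Real.exp (c * |x|) * Real.exp (-b * x ^ 2) : ℝ) : ℂ) * f x) := by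
  have h := (memLp_exp_mul_abs_mul_gauss c hb).ofReal (K := ℂ)
  exact h.integrable_mul (Lp.memLp f)

/-- The Fourier kernel is expanded in its power series and integrated term by term, each term being
a vanishing moment. The Gaussian factor dominates `e^{‖ζ‖|x|}`, which justifies the exchange. -/
theorem eq_zero_of_forall_moment_eq_zero (f : L2R) {b : ℝ} (hb : 0 < b)
    (h : ∀ n : ℕ, ∫ x : ℝ, (x : ℂ) ^ n * ((Real.exp (-b * x ^ 2) : ℝ) * f x) = 0) : f = 0 := by
  set F : ℝ → ℂ := fun x => ((Real.exp (-b * x ^ 2) : ℝ) : ℂ) * f x with hF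
  have hFi : Integrable F := by
    have := integrable_exp_mul_abs_mul_gauss_mul f 0 hb
    refine this.congr (Eventually.of_forall fun x => ?_)
    simp [hF]
  have hz : ∀ᵐ x, F x = 0 := by
    refine ae_eq_zero_of_fourier_eq_zero hFi fun w => ?_
    set ζ : ℂ := -(2 * Real.pi * w * Complex.I) with hζ
    have hsum := hasSum_integral_of_dominated_convergence (μ := (volume : Measure ℝ))
      (F := fun (n : ℕ) x => (ζ * x) ^ n / (n.factorial : ℂ) * F x)
      (f := fun x : ℝ => Real.fourierChar (-(x * w)) • F x)
      (fun n x => (‖ζ‖ * |x|) ^ n / (n.factorial : ℝ) * ‖F x‖) ?_ ?_ ?_ ?_ ?_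
    · refine hsum.unique ?_
      convert hasSum_zero using 1
      ext n
      have e : ∀ x : ℝ, (ζ * x) ^ n / (n.factorial : ℂ) * F x
          = ζ ^ n / (n.factorial : ℂ) * ((x : ℂ) ^ n * F x) := fun x => by ring
      simp only [e]
      rw [integral_const_mul, h n, mul_zero]
    · intro n
      exact (Continuous.aestronglyMeasurable (by fun_prop)).mul hFi.aestronglyMeasurable
    · intro n
      refine Eventually.of_forall fun x => le_of_eq ?_
      simp
    · refine Eventually.of_forall fun x => Summable.mul_right _ ?_
      exact Real.summable_pow_div_factorial _
    · have e : ∀ x : ℝ, ∑' n : ℕ, (‖ζ‖ * |x|) ^ n / (n.factorial : ℝ) * ‖F x‖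
          = ‖((Real.exp (‖ζ‖ * |x|) * Real.exp (-b * x ^ 2) : ℝ) : ℂ) * f x‖ := by
        intro x
        have h1 : ∑' n : ℕ, (‖ζ‖ * |x|) ^ n / (n.factorial : ℝ) = Real.exp (‖ζ‖ * |x|) := by
          rw [Real.exp_eq_exp_ℝ, NormedSpace.exp_eq_tsum_div]
        rw [tsum_mul_right, h1, hF, norm_mul, norm_mul, Complex.norm_real, Complex.norm_real,
          norm_mul, Real.norm_eq_abs (Real.exp (‖ζ‖ * |x|)), Real.abs_exp, mul_assoc]
      simp only [e]
      exact (integrable_exp_mul_abs_mul_gauss_mul f ‖ζ‖ hb).norm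
    · refine Eventually.of_forall fun x => ?_
      have e : Real.fourierChar (-(x * w)) • F x = Complex.exp (ζ * x) * F x := by
        rw [Circle.smul_def, Real.fourierChar_apply, smul_eq_mul, hζ]
        congr 2
        push_cast
        ring
      rw [e]
      apply HasSum.mul_right
      rw [Complex.exp_eq_exp_ℂ]
      exact NormedSpace.expSeries_div_hasSum_exp (ζ * x)
  rw [Lp.eq_zero_iff_ae_eq_zero]
  filter_upwards [hz] with x hx
  simpa [hF] using hx

theorem polyGauss_add (p q : ℝ[X]) {b : ℝ} (hb : 0 < b) :
    polyGauss (p + q) b hb = polyGauss p b hb + polyGauss q b hb := by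
  apply Lp.ext
  filter_upwards [polyGauss_coeFn (p + q) hb, polyGauss_coeFn p hb, polyGauss_coeFn q hb,
    Lp.coeFn_add (polyGauss p b hb) (polyGauss q b hb)] with x h1 h2 h3 h4
  rw [h1, h4, Pi.add_apply, h2, h3, eval_add, add_mul, Complex.ofReal_add]

theorem polyGauss_smul (a : ℝ) (p : ℝ[X]) {b : ℝ} (hb : 0 < b) :
    polyGauss (a • p) b hb = (a : ℂ) • polyGauss p b hb := by
  apply Lp.ext
  filter_upwards [polyGauss_coeFn (a • p) hb, polyGauss_coeFn p hb,
    Lp.coeFn_smul (a : ℂ) (polyGauss p b hb)] with x h1 h2 h3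
  rw [h1, h3, Pi.smul_apply, h2, eval_smul, smul_eq_mul, smul_eq_mul, mul_assoc,
    Complex.ofReal_mul a]

/-- The span contains `1` and is stable under multiplication by `X`, because `X H_n = (H_{n+1} +
H_n') / 2` and `H_n'` is a multiple of `H_{n-1}`. -/
theorem span_hermiteH_eq_top : Submodule.span ℝ (Set.range hermiteH) = ⊤ := by
  set S := Submodule.span ℝ (Set.range hermiteH)
  have hmem (n : ℕ) : hermiteH n ∈ S := Submodule.subset_span ⟨n, rfl⟩
  have hder (n : ℕ) : derivative (hermiteH n) ∈ S := by
    cases n with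
    | zero => simp [hermiteH_zero]
    | succ n =>
      rw [derivative_hermiteH_succ, ← smul_eq_C_mul]
      exact S.smul_mem _ (hmem n)
  have hX (p : ℝ[X]) (hp : p ∈ S) : X * p ∈ S := by
    induction hp using Submodule.span_induction with
    | mem p hp =>
      obtain ⟨n, rfl⟩ := hp
      have e : X * hermiteH n = (1 / 2 : ℝ) • (hermiteH (n + 1) + derivative (hermiteH n)) := by
        rw [hermiteH_succ, smul_eq_C_mul, sub_add_cancel, mul_assoc, ← mul_assoc,
          show (2 : ℝ[X]) = C 2 from rfl, ← map_mul]
        norm_num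
      rw [e]
      exact S.smul_mem _ (S.add_mem (hmem _) (hder n))
    | zero => simp
    | add p q _ _ hp hq => rw [mul_add]; exact S.add_mem hp hq
    | smul a p _ hp => rw [mul_smul_comm]; exact S.smul_mem _ hp
  rw [eq_top_iff]
  rintro p -
  induction p using Polynomial.induction_on' with
  | add p q hp hq => exact S.add_mem hp hq
  | monomial n a =>
    rw [← C_mul_X_pow_eq_monomial, ← smul_eq_C_mul]
    apply S.smul_mem
    induction n with
    | zero => exact hmem 0
    | succ n ih => rw [pow_succ']; exact hX _ ih

theorem isCompleteSeq_hermite {b : ℝ} (hb : 0 < b) :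
    IsCompleteSeq fun n => polyGauss (hermiteN n) b hb := by
  intro f hf
  have hp (p : ℝ[X]) : inner ℂ (polyGauss p b hb) f = 0 := by
    have h : p ∈ Submodule.span ℝ (Set.range hermiteH) := by
      rw [span_hermiteH_eq_top]; exact Submodule.mem_top
    induction h using Submodule.span_induction with
    | mem p hp =>
      obtain ⟨n, rfl⟩ := hp
      have h := inner_eq_zero_symm.mp (hf n)
      simp only [hermiteN, ← smul_eq_C_mul, polyGauss_smul, inner_smul_left] at h
      have := normConst_pos n
      simpa [this.ne'] using h
    | zero =>
      have := polyGauss_smul 0 0 hb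
      simp only [smul_zero, Complex.ofReal_zero, zero_smul] at this
      rw [this, inner_zero_left]
    | add p q _ _ hp hq => rw [polyGauss_add, inner_add_left, hp, hq, add_zero]
    | smul a p _ hp => rw [polyGauss_smul, inner_smul_left, hp, mul_zero]
  refine eq_zero_of_forall_moment_eq_zero f hb fun n => ?_
  rw [← hp (X ^ n), L2.inner_def]
  refine integral_congr_ae ?_
  filter_upwards [polyGauss_coeFn (X ^ n) hb] with x hx
  rw [hx, RCLike.inner_apply, Complex.conj_ofReal]
  simp only [eval_pow, eval_X, Complex.ofReal_mul, Complex.ofReal_pow]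
  ring

theorem isCompleteSeq_xVec : IsCompleteSeq xVec := by
  rw [funext xVec_eq]; exact isCompleteSeq_hermite _

theorem isCompleteSeq_yVec : IsCompleteSeq yVec := by
  rw [funext yVec_eq]; exact isCompleteSeq_hermite _

theorem isCompleteSeq_eVec : IsCompleteSeq eVec := by
  rw [funext eVec_eq]; exact isCompleteSeq_hermite _

/-- The Hermite functions as a Hilbert basis of `L²(ℝ)`. -/
noncomputable def hermiteBasis : HilbertBasis ℕ ℂ L2R :=
  HilbertBasis.mkOfOrthogonalEqBot orthonormal_eVec (by
    rw [Submodule.eq_bot_iff]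
    intro f hf
    refine isCompleteSeq_eVec f fun n => ?_
    have h : eVec n ∈ Submodule.span ℂ (Set.range eVec) := Submodule.subset_span ⟨n, rfl⟩
    exact Submodule.inner_left_of_mem_orthogonal h hf)

theorem hermiteBasis_apply (n : ℕ) : hermiteBasis n = eVec n := by
  simp [hermiteBasis]

/-! ### The operator `T` -/

theorem gaussMul_ne_zero (x : ℝ) : gaussMul x ≠ 0 :=
  Complex.ofReal_ne_zero.mpr (Real.exp_ne_zero _)

theorem opT_isSelfAdjoint : IsSelfAdjoint opT := by
  rw [ContinuousLinearMap.isSelfAdjoint_iff_isSymmetric]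
  intro f g
  change inner ℂ (opT f) g = inner ℂ f (opT g)
  rw [L2.inner_def, L2.inner_def]
  refine integral_congr_ae ?_
  filter_upwards [opT_coeFn f, opT_coeFn g] with x h1 h2
  rw [h1, h2, RCLike.inner_apply, RCLike.inner_apply, map_mul, gaussMul, Complex.conj_ofReal]
  ring

theorem inner_opT_left (f g : L2R) : inner ℂ (opT f) g = inner ℂ f (opT g) :=
  (ContinuousLinearMap.isSelfAdjoint_iff_isSymmetric.mp opT_isSelfAdjoint) f g

theorem opT_injective : Function.Injective opT := by
  rw [injective_iff_map_eq_zero]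
  intro f hf
  have h0 := opT_coeFn f
  rw [hf] at h0
  rw [Lp.eq_zero_iff_ae_eq_zero]
  filter_upwards [h0, Lp.coeFn_zero ℂ 2 (volume : Measure ℝ)] with x h1 h2
  rw [h2] at h1
  simpa [gaussMul_ne_zero] using h1.symm

theorem opT_polyGauss (p : ℝ[X]) {b c : ℝ} (hb : 0 < b) (hc : 0 < c) (h : c = b + 1 / 4) :
    opT (polyGauss p b hb) = polyGauss p c hc := by
  apply Lp.ext
  filter_upwards [opT_coeFn (polyGauss p b hb), polyGauss_coeFn p hb, polyGauss_coeFn p hc]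
    with x h1 h2 h3
  rw [h1, h2, h3, gaussMul, ← Complex.ofReal_mul]
  congr 1
  rw [h, show -(b + 1 / 4) * x ^ 2 = -x ^ 2 / 4 + -b * x ^ 2 by ring, Real.exp_add]
  ring

theorem opT_eVec (n : ℕ) : opT (eVec n) = yVec n := by
  rw [eVec_eq, yVec_eq]; exact opT_polyGauss _ _ _ (by norm_num)

theorem opT_xVec (n : ℕ) : opT (xVec n) = eVec n := by
  rw [eVec_eq, xVec_eq]; exact opT_polyGauss _ _ _ (by norm_num)

theorem exists_opT_eq_of_mem_testFunctions {f : L2R} (hf : f ∈ testFunctions) :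
    ∃ f', opT f' = f := by
  obtain ⟨g, hg, hc, e⟩ := hf
  have hm : MemLp (fun x => (gaussMul x)⁻¹ * g x) 2 volume := by
    have hcont : Continuous gaussMul := by unfold gaussMul; fun_prop
    refine Continuous.memLp_of_hasCompactSupport ?_ hc.mul_left
    exact (hcont.inv₀ gaussMul_ne_zero).mul hg.continuous
  refine ⟨hm.toLp _, ?_⟩
  apply Lp.ext
  filter_upwards [opT_coeFn (hm.toLp _), hm.coeFn_toLp, e] with x h1 h2 h3
  rw [h1, h2, h3, mul_inv_cancel_left₀ (gaussMul_ne_zero x)]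

theorem mem_opTinv_domain {f : L2R} : f ∈ opTinv.domain ↔ ∃ f', opT f' = f := by
  rw [opTinv, LinearPMap.inverse_domain]
  constructor
  · rintro ⟨x, hx⟩
    exact ⟨x, hx⟩
  · rintro ⟨x, hx⟩
    exact ⟨⟨x, Submodule.mem_top⟩, hx⟩

theorem opTinv_apply {f f' : L2R} (h : opT f' = f) (hf : f ∈ opTinv.domain) :
    opTinv ⟨f, hf⟩ = f' := by
  have hker : LinearMap.ker ((opT : L2R →ₗ[ℂ] L2R).toPMap ⊤).toFun = ⊥ := by
    rw [LinearMap.ker_eq_bot']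
    rintro ⟨x, hx⟩ hx0
    have : x = 0 := opT_injective (by rw [map_zero]; exact hx0)
    exact Subtype.ext this
  exact LinearPMap.inverse_apply_eq hker (x := ⟨f', Submodule.mem_top⟩) h

theorem testFunctions_le_opTinv_domain : testFunctions ≤ opTinv.domain := fun _ hf =>
  mem_opTinv_domain.mpr (exists_opT_eq_of_mem_testFunctions hf)

theorem xVec_eq_opTinv (n : ℕ) : ∃ h : eVec n ∈ opTinv.domain, xVec n = opTinv ⟨eVec n, h⟩ :=
  ⟨mem_opTinv_domain.mpr ⟨_, opT_xVec n⟩, (opTinv_apply (opT_xVec n) _).symm⟩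

/-! ### Quasi bases and the operator `S_y` -/

theorem dense_testFunctions : Dense (testFunctions : Set L2R) := by
  refine (Lp.dense_hasCompactSupport_contDiff (E := ℝ) (F := ℂ) (p := 2) (μ := volume)
    ENNReal.ofNat_ne_top).mono ?_
  rintro f ⟨g, h1, h2, h3⟩
  exact ⟨g, h3, h2, h1⟩

theorem isQuasiBases_xVec_yVec : IsQuasiBases testFunctions xVec yVec where
  dense := dense_testFunctions
  biorthogonal := isBiorthogonal_xVec_yVec
  hasSum_left f hf g hg := by
    -- With `f = T f'`, Parseval for `f'` and `T g` suffices: `⟨T f', x_n⟩ = ⟨f', e_n⟩` and `⟨y_n,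
    -- g⟩ = ⟨e_n, T g⟩`.
    obtain ⟨f', rfl⟩ := exists_opT_eq_of_mem_testFunctions hf
    have h := hermiteBasis.hasSum_inner_mul_inner f' (opT g)
    simpa only [hermiteBasis_apply, inner_opT_left, opT_xVec, ← opT_eVec] using h
  hasSum_right f hf g hg := by
    obtain ⟨g', rfl⟩ := exists_opT_eq_of_mem_testFunctions hg
    have h := hermiteBasis.hasSum_inner_mul_inner (opT f) g'
    simpa only [hermiteBasis_apply, ← inner_opT_left, opT_xVec, ← opT_eVec] using h

/-- This is `T` applied to the expansion of `T f` in the basis `e_n`. -/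
theorem hasSum_inner_yVec_smul (f : L2R) :
    HasSum (fun n => (inner ℂ (yVec n) f : ℂ) • yVec n) (opT (opT f)) := by
  have h := (hermiteBasis.hasSum_repr (opT f)).mapL opT
  simpa only [HilbertBasis.repr_apply_apply, hermiteBasis_apply, map_smul, ← inner_opT_left,
    opT_eVec] using h

theorem seriesOp_yVec :
    seriesOp yVec = ((opT ∘L opT : L2R →L[ℂ] L2R) : L2R →ₗ[ℂ] L2R).toPMap ⊤ := by
  refine LinearPMap.ext ?_ ?_
  · rw [LinearMap.toPMap_domain, eq_top_iff]
    exact fun f _ => (hasSum_inner_yVec_smul f).summable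
  · intro f hf hf'
    exact (hasSum_inner_yVec_smul f).tsum_eq

/-! ### Failure of the basis property -/

section Basis

variable {E : Type*} [NormedAddCommGroup E] [InnerProductSpace ℂ E] [CompleteSpace E]

/-- A Schauder basis and its biorthogonal sequence have bounded products of norms. -/
theorem IsBasisSeq.bddAbove_norm_mul_norm {φ ψ : ℕ → E} (hφ : IsBasisSeq φ)
    (h : ∀ n m : ℕ, inner ℂ (ψ n) (φ m) = if n = m then (1 : ℂ) else 0) :
    BddAbove (Set.range fun n => ‖φ n‖ * ‖ψ n‖) := by
  -- The rank one operators `f ↦ ⟨ψ_n, f⟩ φ_n` have norm `‖φ_n‖ ‖ψ_n‖`. They are pointwise bounded,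
  -- since their values are the terms of the convergent expansion of `f`.
  obtain ⟨K, hK⟩ := banach_steinhaus (g := fun n => InnerProductSpace.rankOne ℂ (φ n) (ψ n))
    (fun f => by
      obtain ⟨c, hc, -⟩ := hφ f
      have hcoef (n : ℕ) : inner ℂ (ψ n) f = c n := by
        have h1 := ((innerSL ℂ (ψ n)).continuous.tendsto f).comp hc
        refine tendsto_nhds_unique h1 (tendsto_const_nhds.congr' ?_)
        filter_upwards [eventually_gt_atTop n] with N hN
        rw [Function.comp_apply, innerSL_apply_apply, inner_sum]
        simp only [inner_smul_right, h, mul_ite, mul_one, mul_zero]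
        rw [Finset.sum_ite_eq, if_pos (Finset.mem_range.mpr hN)]
      have hlim : Tendsto (fun n => c n • φ n) atTop (𝓝 0) := by
        have h1 := (hc.comp (tendsto_add_atTop_nat 1)).sub hc
        rw [sub_self] at h1
        refine h1.congr fun n => ?_
        rw [Function.comp_apply, Finset.sum_range_succ, add_sub_cancel_left]
      obtain ⟨K, hK⟩ := hlim.norm.bddAbove_range
      exact ⟨K, fun n => by
        rw [InnerProductSpace.rankOne_apply, hcoef]
        exact hK ⟨n, rfl⟩⟩)
  refine ⟨K, ?_⟩
  rintro _ ⟨n, rfl⟩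
  simpa using hK n

end Basis

theorem not_isBasisSeq_xVec : ¬ IsBasisSeq xVec := fun h => by
  refine not_bddAbove_norm_mul_norm ?_
  have := h.bddAbove_norm_mul_norm (ψ := yVec) fun n m => by
    rw [xVec_eq, yVec_eq, inner_hermite _ _ (by norm_num)]
  simpa only [mul_comm] using this

theorem not_isBasisSeq_yVec : ¬ IsBasisSeq yVec := fun h =>
  not_bddAbove_norm_mul_norm (h.bddAbove_norm_mul_norm isBiorthogonal_xVec_yVec)

/-! ### Polynomials times Gaussians as Schwartz functions -/

theorem exists_abs_poly_mul_gauss_le (p : ℝ[X]) {b : ℝ} (hb : 0 < b) :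
    ∃ K : ℝ, ∀ x : ℝ, |p.eval x * Real.exp (-b * x ^ 2)| ≤ K := by
  induction p using Polynomial.induction_on' with
  | add p q hp hq =>
    obtain ⟨K, hK⟩ := hp
    obtain ⟨L, hL⟩ := hq
    refine ⟨K + L, fun x => ?_⟩
    rw [eval_add, add_mul]
    exact (abs_add_le _ _).trans (add_le_add (hK x) (hL x))
  | monomial n a =>
    -- From `|x|^n ≤ 1 + x^{2n}` and `(bx²)^n / n! ≤ e^{bx²}`.
    refine ⟨|a| * (1 + n.factorial / b ^ n), fun x => ?_⟩
    rw [eval_monomial, mul_assoc, abs_mul]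
    gcongr
    rw [abs_mul, abs_pow, Real.abs_exp]
    have h1 : |x| ^ n ≤ 1 + (x ^ 2) ^ n := by
      rw [← sq_abs, ← pow_mul, mul_comm, pow_mul]
      nlinarith [sq_nonneg (|x| ^ n - 1), sq_nonneg (|x| ^ n)]
    have h2 : (x ^ 2) ^ n ≤ n.factorial / b ^ n * Real.exp (b * x ^ 2) := by
      have h := Real.pow_div_factorial_le_exp (x := b * x ^ 2) (by positivity) n
      rw [div_le_iff₀ (by positivity), mul_pow] at h
      rw [div_mul_eq_mul_div, le_div_iff₀ (by positivity)]
      linarith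
    have h3 : Real.exp (-b * x ^ 2) ≤ 1 := by
      rw [Real.exp_le_one_iff]; nlinarith [sq_nonneg x]
    have h4 : Real.exp (b * x ^ 2) * Real.exp (-b * x ^ 2) = 1 := by
      rw [← Real.exp_add]; simp
    calc |x| ^ n * Real.exp (-b * x ^ 2)
        ≤ (1 + n.factorial / b ^ n * Real.exp (b * x ^ 2)) * Real.exp (-b * x ^ 2) := by
          gcongr; linarith
      _ = Real.exp (-b * x ^ 2)
          + n.factorial / b ^ n * (Real.exp (b * x ^ 2) * Real.exp (-b * x ^ 2)) := by ring
      _ ≤ 1 + n.factorial / b ^ n := by rw [h4, mul_one]; gcongr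

/-- The function `p(x) e^{-b x²}`. -/
noncomputable def polyGaussFun (p : ℝ[X]) (b x : ℝ) : ℂ :=
  ((p.eval x * Real.exp (-b * x ^ 2) : ℝ) : ℂ)

theorem deriv_polyGaussFun (p : ℝ[X]) (b : ℝ) :
    deriv (polyGaussFun p b) = polyGaussFun (derivative p - C (2 * b) * (X * p)) b :=
  funext fun x => (hasDerivAt_poly_mul_gauss p b x).ofReal_comp.deriv

theorem contDiff_polyGaussFun (p : ℝ[X]) (b : ℝ) : ContDiff ℝ ∞ (polyGaussFun p b) :=
  Complex.ofRealCLM.contDiff.comp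
    (f := fun x : ℝ => p.eval x * Real.exp (-b * x ^ 2)) ((p.contDiff_aeval ∞).mul (by fun_prop))

theorem exists_iteratedDeriv_polyGaussFun (p : ℝ[X]) (b : ℝ) (n : ℕ) :
    ∃ q : ℝ[X], iteratedDeriv n (polyGaussFun p b) = polyGaussFun q b := by
  induction n with
  | zero => exact ⟨p, iteratedDeriv_zero⟩
  | succ n ih =>
    obtain ⟨q, hq⟩ := ih
    exact ⟨_, by rw [iteratedDeriv_succ, hq, deriv_polyGaussFun]⟩

/-- `p(x) e^{-b x²}` as a Schwartz function. -/
noncomputable def polyGaussS (p : ℝ[X]) (b : ℝ) (hb : 0 < b) : 𝓢(ℝ, ℂ) where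
  toFun := polyGaussFun p b
  smooth' := contDiff_polyGaussFun p b
  decay' k n := by
    obtain ⟨q, hq⟩ := exists_iteratedDeriv_polyGaussFun p b n
    obtain ⟨K, hK⟩ := exists_abs_poly_mul_gauss_le (X ^ k * q) hb
    refine ⟨K, fun x => le_trans (le_of_eq ?_) (hK x)⟩
    rw [norm_iteratedFDeriv_eq_norm_iteratedDeriv, hq, polyGaussFun, Complex.norm_real,
      Real.norm_eq_abs, Real.norm_eq_abs, ← abs_pow, ← abs_mul, eval_mul, eval_pow, eval_X,
      mul_assoc]

theorem polyGaussS_coe (p : ℝ[X]) {b : ℝ} (hb : 0 < b) :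
    ⇑(polyGaussS p b hb) = polyGaussFun p b := rfl

theorem schwartzToL2_coeFn (φ : 𝓢(ℝ, ℂ)) : schwartzToL2 φ =ᵐ[volume] φ :=
  φ.coeFn_toLp 2 volume

theorem schwartzToL2_polyGaussS (p : ℝ[X]) {b : ℝ} (hb : 0 < b) :
    schwartzToL2 (polyGaussS p b hb) = polyGauss p b hb := by
  apply Lp.ext
  filter_upwards [schwartzToL2_coeFn (polyGaussS p b hb), polyGauss_coeFn p hb] with x h1 h2
  rw [h1, h2]; rfl

/-! ### Eigenvectors -/

theorem isEigenvectorOf_schwartzOp {A : 𝓢(ℝ, ℂ) →ₗ[ℂ] 𝓢(ℝ, ℂ)} {μ : ℂ} {φ : 𝓢(ℝ, ℂ)}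
    (h0 : schwartzToL2 φ ≠ 0) (h : A φ = μ • φ) :
    IsEigenvectorOf (schwartzOp A) μ (schwartzToL2 φ) :=
  ⟨h0, LinearMap.mem_range_self _ _, by rw [schwartzOp_apply, h, map_smul]⟩

theorem hermiteN_ode (n : ℕ) :
    derivative (derivative (hermiteN n)) =
      2 * X * derivative (hermiteN n) - C (2 * n : ℝ) * hermiteN n := by
  rw [hermiteN, derivative_C_mul, derivative_C_mul, hermiteH_ode]
  ring

theorem yVec_isEigenvectorOf (n : ℕ) : IsEigenvectorOf opH1 ((n : ℂ) + 1 / 2) (yVec n) := by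
  have h0 : yVec n ≠ 0 := fun h => by
    have := isBiorthogonal_xVec_yVec n n
    simp [h] at this
  rw [yVec_eq, ← schwartzToL2_polyGaussS] at h0 ⊢
  refine isEigenvectorOf_schwartzOp h0 (SchwartzMap.ext fun x => ?_)
  have h := congrArg (fun p => ((eval x p : ℝ) : ℂ)) (hermiteN_ode n)
  rw [formH1_apply, smul_apply, polyGaussS_coe, deriv_polyGaussFun, deriv_polyGaussFun]
  simp only [polyGaussFun, smul_eq_mul, derivative_sub, derivative_mul, derivative_C, derivative_X,
    eval_sub, eval_add, eval_mul, eval_C, eval_X, eval_zero, eval_one, eval_ofNat] at h ⊢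
  push_cast at h ⊢
  -- Once the Gaussian is factored out, the eigenvalue equation is `-1/2` times the Hermite
  -- equation.
  linear_combination (-1 / 2 : ℂ) * Complex.exp (-(3 / 4) * (x : ℂ) ^ 2) * h

theorem xVec_isEigenvectorOf (n : ℕ) : IsEigenvectorOf opH2 ((n : ℂ) + 1 / 2) (xVec n) := by
  have h0 : xVec n ≠ 0 := fun h => by
    have := isBiorthogonal_xVec_yVec n n
    simp [h] at this
  rw [xVec_eq, ← schwartzToL2_polyGaussS] at h0 ⊢
  refine isEigenvectorOf_schwartzOp h0 (SchwartzMap.ext fun x => ?_)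
  have h := congrArg (fun p => ((eval x p : ℝ) : ℂ)) (hermiteN_ode n)
  rw [formH2_apply, smul_apply, polyGaussS_coe, deriv_polyGaussFun, deriv_polyGaussFun]
  simp only [polyGaussFun, smul_eq_mul, derivative_sub, derivative_mul, derivative_C, derivative_X,
    eval_sub, eval_add, eval_mul, eval_C, eval_X, eval_zero, eval_one, eval_ofNat] at h ⊢
  push_cast at h ⊢
  linear_combination (-1 / 2 : ℂ) * Complex.exp (-(1 / 4) * (x : ℂ) ^ 2) * h

/-! ### Operators that agree with `H_1` or `H_2` on test functions are not self-adjoint -/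

/-- A real test function as a complex Schwartz function. -/
noncomputable def realTestS (u : ℝ → ℝ) (hu : ContDiff ℝ ∞ u) (hc : HasCompactSupport u) :
    𝓢(ℝ, ℂ) :=
  HasCompactSupport.toSchwartzMap (f := fun x => (u x : ℂ)) (hc.comp_left Complex.ofReal_zero)
    (Complex.ofRealCLM.contDiff.comp hu)

theorem realTestS_coe (u : ℝ → ℝ) (hu : ContDiff ℝ ∞ u) (hc : HasCompactSupport u) :
    ⇑(realTestS u hu hc) = fun x => (u x : ℂ) := rfl

theorem realTestS_mem_testFunctions (u : ℝ → ℝ) (hu : ContDiff ℝ ∞ u) (hc : HasCompactSupport u) :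
    schwartzToL2 (realTestS u hu hc) ∈ testFunctions :=
  ⟨_, Complex.ofRealCLM.contDiff.comp hu, hc.comp_left Complex.ofReal_zero,
    schwartzToL2_coeFn (realTestS u hu hc)⟩

/-- A self-adjoint operator is symmetric on its domain, and symmetry passes to the restriction to
test functions, where `A` is `F`. -/
theorem inner_eq_inner_of_isSelfAdjoint {F : 𝓢(ℝ, ℂ) →ₗ[ℂ] 𝓢(ℝ, ℂ)} {A : L2R →ₗ.[ℂ] L2R}
    (hA : (schwartzOp F).domRestrict testFunctions ≤ A) (hs : IsSelfAdjoint A) {φ ψ : 𝓢(ℝ, ℂ)}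
    (hφ : schwartzToL2 φ ∈ testFunctions) (hψ : schwartzToL2 ψ ∈ testFunctions) :
    inner ℂ (schwartzToL2 (F φ)) (schwartzToL2 ψ)
      = inner ℂ (schwartzToL2 φ) (schwartzToL2 (F ψ)) := by
  have hval {χ : 𝓢(ℝ, ℂ)} (hχ : schwartzToL2 χ ∈ testFunctions) :
      ∃ h : schwartzToL2 χ ∈ A.domain, A ⟨schwartzToL2 χ, h⟩ = schwartzToL2 (F χ) := by
    have hd : schwartzToL2 χ ∈ ((schwartzOp F).domRestrict testFunctions).domain :=
      ⟨hχ, LinearMap.mem_range_self _ _⟩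
    refine ⟨hA.1 hd, ?_⟩
    rw [← hA.2 (x := ⟨_, hd⟩) rfl, ← schwartzOp_apply]
    exact LinearPMap.domRestrict_apply rfl
  have hform : A.IsFormalAdjoint A := by
    have h := LinearPMap.adjoint_isFormalAdjoint hs.dense_domain
    rwa [LinearPMap.isSelfAdjoint_def.mp hs] at h
  obtain ⟨h1, e1⟩ := hval hφ
  obtain ⟨h2, e2⟩ := hval hψ
  rw [← e1, ← e2]
  exact hform ⟨_, h1⟩ ⟨_, h2⟩

theorem inner_schwartzToL2 (φ ψ : 𝓢(ℝ, ℂ)) :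
    inner ℂ (schwartzToL2 φ) (schwartzToL2 ψ) = ∫ x, ψ x * starRingEnd ℂ (φ x) := by
  rw [L2.inner_def]
  refine integral_congr_ae ?_
  filter_upwards [schwartzToL2_coeFn φ, schwartzToL2_coeFn ψ] with x h1 h2
  rw [h1, h2, RCLike.inner_apply]

/-- `½ [ -d²/dx² + ε x d/dx + ½ (3x²/2 + ε) ]` on real functions; the cases `ε = ∓ 1` are `H_1` and
`H_2`. -/
noncomputable def realForm (ε : ℝ) (u : ℝ → ℝ) (x : ℝ) : ℝ :=
  1 / 2 * (-deriv (deriv u) x + ε * x * deriv u x + 1 / 2 * (3 * x ^ 2 / 2 + ε) * u x)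

theorem contDiff_deriv {u : ℝ → ℝ} (hu : ContDiff ℝ ∞ u) : ContDiff ℝ ∞ (deriv u) :=
  (contDiff_infty_iff_deriv.mp hu).2

theorem deriv_ofReal_comp {u : ℝ → ℝ} (hu : Differentiable ℝ u) :
    deriv (fun x => (u x : ℂ)) = fun x => ((deriv u x : ℝ) : ℂ) :=
  funext fun x => (hu x).hasDerivAt.ofReal_comp.deriv

theorem formH1_realTestS (u : ℝ → ℝ) (hu : ContDiff ℝ ∞ u) (hc : HasCompactSupport u) (x : ℝ) :
    formH1 (realTestS u hu hc) x = (realForm (-1) u x : ℂ) := by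
  rw [formH1_apply, realTestS_coe, deriv_ofReal_comp (hu.differentiable (by simp)),
    deriv_ofReal_comp ((contDiff_deriv hu).differentiable (by simp)), realForm]
  push_cast
  ring

theorem formH2_realTestS (u : ℝ → ℝ) (hu : ContDiff ℝ ∞ u) (hc : HasCompactSupport u) (x : ℝ) :
    formH2 (realTestS u hu hc) x = (realForm 1 u x : ℂ) := by
  rw [formH2_apply, realTestS_coe, deriv_ofReal_comp (hu.differentiable (by simp)),
    deriv_ofReal_comp ((contDiff_deriv hu).differentiable (by simp)), realForm]
  push_cast
  ring

/-- For `v = x² u` the Wronskian is `W = u v' - v u' = 2x u²`, and the left side is `-W'/2 + ε x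
W/2`. The first term integrates to zero, while the second has a definite sign. -/
theorem realForm_sq_mul {u : ℝ → ℝ} (hu : ContDiff ℝ ∞ u) (ε x : ℝ) :
    u x * realForm ε (fun x => x ^ 2 * u x) x - realForm ε u x * (x ^ 2 * u x) =
      ε * (x ^ 2 * u x ^ 2) - deriv (fun x => x * u x ^ 2) x := by
  have hd (x : ℝ) : HasDerivAt u (deriv u x) x := (hu.differentiable (by simp) x).hasDerivAt
  have hd' (x : ℝ) : HasDerivAt (deriv u) (deriv (deriv u) x) x :=
    ((contDiff_deriv hu).differentiable (by simp) x).hasDerivAt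
  have e1 : deriv (fun x => x ^ 2 * u x) = fun x => 2 * x * u x + x ^ 2 * deriv u x :=
    funext fun x => by
      rw [((hasDerivAt_pow 2 x).fun_mul (hd x)).deriv]; simp
  have e2 : deriv (fun x => 2 * x * u x + x ^ 2 * deriv u x) x =
      2 * u x + 4 * x * deriv u x + x ^ 2 * deriv (deriv u) x := by
    rw [((((hasDerivAt_id' x).const_mul 2).fun_mul (hd x)).fun_add
      ((hasDerivAt_pow 2 x).fun_mul (hd' x))).deriv]
    simp; ring
  have e3 : deriv (fun x => x * u x ^ 2) x = u x ^ 2 + 2 * x * u x * deriv u x := by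
    rw [((hasDerivAt_id' x).fun_mul ((hd x).fun_pow 2)).deriv]
    simp; ring
  rw [realForm, realForm, e1, e2, e3]
  ring

theorem not_isSelfAdjoint_of_realForm {F : 𝓢(ℝ, ℂ) →ₗ[ℂ] 𝓢(ℝ, ℂ)} {ε : ℝ} (hε : ε ≠ 0)
    (hF : ∀ (u : ℝ → ℝ) (hu : ContDiff ℝ ∞ u) (hc : HasCompactSupport u) (x : ℝ),
      F (realTestS u hu hc) x = (realForm ε u x : ℂ)) (A : L2R →ₗ.[ℂ] L2R)
    (hA : (schwartzOp F).domRestrict testFunctions ≤ A) : ¬ IsSelfAdjoint A := by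
  intro hs
  -- Inner radius `2` ensures `u 1 = 1`, so that `x² u²` is nonzero at `1` and has positive
  -- integral.
  let B : ContDiffBump (0 : ℝ) := ⟨2, 3, by norm_num, by norm_num⟩
  set u : ℝ → ℝ := fun x => B x
  have hu : ContDiff ℝ ∞ u := B.contDiff
  have hc : HasCompactSupport u := B.hasCompactSupport
  have hu1 : u 1 = 1 := B.one_of_mem_closedBall (by simp [B])
  have hv : ContDiff ℝ ∞ fun x => x ^ 2 * u x := (contDiff_id.pow 2).mul hu
  have hvc : HasCompactSupport fun x => x ^ 2 * u x := hc.mul_left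
  have key := inner_eq_inner_of_isSelfAdjoint hA hs (realTestS_mem_testFunctions u hu hc)
    (realTestS_mem_testFunctions _ hv hvc)
  rw [inner_schwartzToL2, inner_schwartzToL2] at key
  simp only [hF, realTestS_coe, Complex.conj_ofReal, ← Complex.ofReal_mul] at key
  rw [integral_complex_ofReal, integral_complex_ofReal, Complex.ofReal_inj] at key
  have hcont (w : ℝ → ℝ) (hw : ContDiff ℝ ∞ w) : Continuous (realForm ε w) := by
    have h1 : Continuous (deriv w) := (contDiff_deriv hw).continuous
    have h2 : Continuous (deriv (deriv w)) := (contDiff_deriv (contDiff_deriv hw)).continuous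
    have h0 := hw.continuous
    unfold realForm
    fun_prop
  have i1 : Integrable fun x => x ^ 2 * u x * realForm ε u x :=
    (hv.continuous.mul (hcont u hu)).integrable_of_hasCompactSupport hvc.mul_right
  have i2 : Integrable fun x => realForm ε (fun x => x ^ 2 * u x) x * u x :=
    ((hcont _ hv).mul hu.continuous).integrable_of_hasCompactSupport hc.mul_left
  have hwd : ContDiff ℝ ∞ fun x => x * u x ^ 2 := contDiff_id.mul (hu.pow 2)
  have hsq : HasCompactSupport fun x => u x ^ 2 := hc.comp_left (g := fun y : ℝ => y ^ 2) (by simp)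
  have hwc : HasCompactSupport fun x => x * u x ^ 2 := hsq.mul_left
  have i3 : Integrable (deriv fun x => x * u x ^ 2) :=
    (contDiff_deriv hwd).continuous.integrable_of_hasCompactSupport hwc.deriv
  have h3 : ∫ x, deriv (fun x => x * u x ^ 2) x = 0 :=
    integral_eq_zero_of_hasDerivAt_of_integrable
      (fun x => (hwd.differentiable (by simp) x).hasDerivAt) i3
      (hwd.continuous.integrable_of_hasCompactSupport hwc)
  have hc4 : Continuous fun x => x ^ 2 * u x ^ 2 := by have := hu.continuous; fun_prop
  have hs4 : HasCompactSupport fun x => x ^ 2 * u x ^ 2 := hsq.mul_left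
  have i4 := hc4.integrable_of_hasCompactSupport hs4 (μ := volume)
  have h4 : 0 < ∫ x, x ^ 2 * u x ^ 2 :=
    hc4.integral_pos_of_hasCompactSupport_nonneg_nonzero hs4 (x := 1)
      (fun x => by simp only [Pi.zero_apply]; positivity) (by simp [hu1])
  -- Symmetry makes the left side zero, whereas the right side equals `ε ∫ x² u² ≠ 0`.
  have h5 : ∫ x, (realForm ε (fun x => x ^ 2 * u x) x * u x - x ^ 2 * u x * realForm ε u x)
      = ∫ x, (ε * (x ^ 2 * u x ^ 2) - deriv (fun x => x * u x ^ 2) x) :=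
    integral_congr_ae (Eventually.of_forall fun x => by
      simp only [← realForm_sq_mul hu]; ring)
  rw [integral_sub i2 i1, integral_sub (i4.const_mul ε) i3, integral_const_mul, h3, ← key, sub_self,
    sub_zero] at h5
  exact mul_ne_zero hε h4.ne' h5.symm

end GaussHermite

theorem mainTheorem5 :
    -- `T` is a self-adjoint injection with densely defined inverse, `y_n = T e_n`, `x_n = T⁻¹ e_n`
    IsSelfAdjoint opT ∧ Function.Injective opT ∧
    testFunctions ≤ opTinv.domain ∧
    (∀ n : ℕ, yVec n = opT (eVec n)) ∧
    (∀ n : ℕ, ∃ h : eVec n ∈ opTinv.domain, xVec n = opTinv ⟨eVec n, h⟩) ∧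
    -- biorthogonal, complete, quasi bases
    IsBiorthogonal xVec yVec ∧
    IsCompleteSeq xVec ∧ IsCompleteSeq yVec ∧
    IsQuasiBases testFunctions xVec yVec ∧
    -- norms, their growth, failure of the basis property
    (∀ n : ℕ, ‖yVec n‖ ^ 2 =
      √(2 / 3) * (1 / √3 ^ n) * (legendreP n).eval (2 / √3)) ∧
    (∀ n : ℕ, ‖xVec n‖ ^ 2 = √2 * √3 ^ n * (legendreP n).eval (2 / √3)) ∧
    ((fun n : ℕ => ‖yVec n‖ ^ 2 * ‖xVec n‖ ^ 2) ~[atTop]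
      fun n : ℕ => √3 / Real.pi * ((3 : ℝ) ^ n / n)) ∧
    ¬ BddAbove (Set.range fun n : ℕ => ‖yVec n‖ * ‖xVec n‖) ∧
    ¬ IsBasisSeq xVec ∧ ¬ IsBasisSeq yVec ∧
    -- eigenvectors of `H_1`, `H_2`
    (∀ n : ℕ, IsEigenvectorOf opH1 ((n : ℂ) + 1 / 2) (yVec n)) ∧
    (∀ n : ℕ, IsEigenvectorOf opH2 ((n : ℂ) + 1 / 2) (xVec n)) ∧
    -- no operator that agrees with `H_1` (or with `H_2`) on `D(ℝ)` is self-adjoint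
    (∀ A : L2R →ₗ.[ℂ] L2R, opH1.domRestrict testFunctions ≤ A → ¬ IsSelfAdjoint A) ∧
    (∀ A : L2R →ₗ.[ℂ] L2R, opH2.domRestrict testFunctions ≤ A → ¬ IsSelfAdjoint A) ∧
    -- `S_y` is everywhere defined and equals `T²`
    seriesOp yVec = ((opT ∘L opT : L2R →L[ℂ] L2R) : L2R →ₗ[ℂ] L2R).toPMap ⊤ := by
  exact ⟨opT_isSelfAdjoint, opT_injective, testFunctions_le_opTinv_domain,
    fun n => (opT_eVec n).symm, xVec_eq_opTinv, isBiorthogonal_xVec_yVec, isCompleteSeq_xVec,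
    isCompleteSeq_yVec,
    isQuasiBases_xVec_yVec, norm_sq_yVec, norm_sq_xVec, norm_sq_mul_norm_sq_isEquivalent,
    not_bddAbove_norm_mul_norm, not_isBasisSeq_xVec, not_isBasisSeq_yVec, yVec_isEigenvectorOf,
    xVec_isEigenvectorOf,
    not_isSelfAdjoint_of_realForm (neg_ne_zero.mpr one_ne_zero) formH1_realTestS,
    not_isSelfAdjoint_of_realForm one_ne_zero formH2_realTestS, seriesOp_yVec⟩
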